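/- Let $\mathfrak g=\mathfrak{sl}_2(\mathbb C)$ with standard basis $e,f,h$, let $V=\mathbb Cx\oplus\mathbb Cy$ be its two-dimensional representation ($[e,y]=x$, $[f,x]=y$, $[h,x]=x$, $[h,y]=-y$, $[e,x]=[f,y]=0$), and let $z$ be any element of the center of $U\mathfrak g$. The infinitesimal Hecke algebra $H_z$ is the quotient of the semidirect product $U\mathfrak g\ltimes TV$ (the algebra generated by $U\mathfrak g$ and the tensor algebra $TV$ with $[a,v]=a\cdot v$ for $a\in\mathfrak g$, $v\in V$) by the relation $[x,y]=z$. It carries the algebra filtration in which $U\mathfrak g$ has degree $0$ and $x,y$ have degree $1$. Let $\Delta=h^2+4ef-2h$, a multiple of the Casimir element. Theorem. There is a polynomial $\omega_z\in\mathbb C[\Delta]$ such that, in $H_z$, $$[x,\omega_z]=\tfrac14\big([\Delta z-z,x]+z[\Delta,x]-\Delta[z,x]\big).$$ For every such $\omega_z$, put $$t_z=ey^2+hxy-fx^2-\tfrac12hz-\omega_z\in H_z .$$ Then $t_z$ is transcendental over $\mathbb C$, the center of $H_z$ is exactly $\mathbb C[t_z]$ (so the center is a polynomial algebra in one variable generated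 by $t_z$), and $t_z$ has filtration degree exactly $2$. -/

import Mathlib

open Polynomial
open scoped Matrix

noncomputable section

namespace InfHecke

/-- The Lie algebra `𝔤 = sl₂(ℂ)` of traceless `2 × 2` matrices. -/
abbrev 𝔤 : Type := LieAlgebra.SpecialLinear.sl (Fin 2) ℂ

/-- Its universal enveloping algebra `U𝔤`. -/
abbrev U : Type := UniversalEnvelopingAlgebra ℂ 𝔤

/-- The two-dimensional representation `V = ℂ²`; `A : 𝔤` acts by `v ↦ A.val *ᵥ v`. -/
abbrev V : Type := Fin 2 → ℂ

/-- `e = [[0, 1], [0, 0]]`. -/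
def e : 𝔤 := LieAlgebra.SpecialLinear.single 0 1 (by decide) 1

/-- `f = [[0, 0], [1, 0]]`. -/
def f : 𝔤 := LieAlgebra.SpecialLinear.single 1 0 (by decide) 1

/-- `h = [[1, 0], [0, -1]]`. -/
def h : 𝔤 := LieAlgebra.SpecialLinear.singleSubSingle 0 1 1

/-- An element of `𝔤` as an element of `U𝔤`. -/
def toU (A : 𝔤) : U := UniversalEnvelopingAlgebra.ι ℂ A

/-- The multiple `Δ = h² + 4ef - 2h` of the Casimir element. -/
def casimir : U := toU h ^ 2 + 4 * (toU e * toU f) - 2 * toU h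

/-- The relations of the semidirect product `U𝔤 ⋉ TV`: the tensor algebra on `U𝔤 × V` contains
copies of `U𝔤` (as a vector space) and of `TV`; the first two relations restore the product and
the unit of `U𝔤`, the third says that `[A, v] = A · v` for `A ∈ 𝔤` and `v ∈ V`. -/
inductive SemidirectRel : TensorAlgebra ℂ (U × V) → TensorAlgebra ℂ (U × V) → Prop
  | one : SemidirectRel (TensorAlgebra.ι ℂ ((1 : U), (0 : V))) 1
  | mul (a b : U) : SemidirectRel (TensorAlgebra.ι ℂ (a * b, (0 : V)))
      (TensorAlgebra.ι ℂ (a, (0 : V)) * TensorAlgebra.ι ℂ (b, (0 : V)))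
  | act (A : 𝔤) (v : V) : SemidirectRel
      (TensorAlgebra.ι ℂ (toU A, (0 : V)) * TensorAlgebra.ι ℂ ((0 : U), v))
      (TensorAlgebra.ι ℂ ((0 : U), A.val *ᵥ v) +
        TensorAlgebra.ι ℂ ((0 : U), v) * TensorAlgebra.ι ℂ (toU A, (0 : V)))

/-- The semidirect (smash) product `U𝔤 ⋉ TV`. -/
def Semidirect : Type := (ringConGen SemidirectRel).Quotient

instance : Ring Semidirect := inferInstanceAs (Ring (ringConGen SemidirectRel).Quotient)

instance : Algebra ℂ Semidirect :=
  inferInstanceAs (Algebra ℂ (ringConGen SemidirectRel).Quotient)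

/-- The quotient map onto `U𝔤 ⋉ TV`. -/
def Semidirect.mk : TensorAlgebra ℂ (U × V) →ₐ[ℂ] Semidirect :=
  RingCon.mkₐ ℂ (ringConGen SemidirectRel)

theorem Semidirect.mk_rel {a b : TensorAlgebra ℂ (U × V)} (hab : SemidirectRel a b) :
    Semidirect.mk a = Semidirect.mk b :=
  Quotient.sound (RingCon.le_ringConGen _ _ hab)

/-- The algebra map `U𝔤 → U𝔤 ⋉ TV`. -/
def Semidirect.inU : U →ₐ[ℂ] Semidirect :=
  AlgHom.ofLinearMap
    (Semidirect.mk.toLinearMap ∘ₗ TensorAlgebra.ι ℂ ∘ₗ LinearMap.inl ℂ U V)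
    (by simpa using Semidirect.mk_rel SemidirectRel.one)
    (fun a b => by simpa using Semidirect.mk_rel (SemidirectRel.mul a b))

/-- The linear map `V → U𝔤 ⋉ TV`. -/
def Semidirect.inV : V →ₗ[ℂ] Semidirect :=
  Semidirect.mk.toLinearMap ∘ₗ TensorAlgebra.ι ℂ ∘ₗ LinearMap.inr ℂ U V

/-- The relation `[x, y] = z`, where `x = (1, 0)` and `y = (0, 1)`. -/
inductive HeckeRel (z : U) : Semidirect → Semidirect → Prop
  | comm : HeckeRel z (Semidirect.inV ![1, 0] * Semidirect.inV ![0, 1])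
      (Semidirect.inV ![0, 1] * Semidirect.inV ![1, 0] + Semidirect.inU z)

/-- The infinitesimal Hecke algebra `H_z` of `sl₂`. -/
def H (z : U) : Type := (ringConGen (HeckeRel z)).Quotient

instance (z : U) : Ring (H z) := inferInstanceAs (Ring (ringConGen (HeckeRel z)).Quotient)

instance (z : U) : Algebra ℂ (H z) :=
  inferInstanceAs (Algebra ℂ (ringConGen (HeckeRel z)).Quotient)

/-- The quotient map `U𝔤 ⋉ TV → H_z`. -/
def mkH (z : U) : Semidirect →ₐ[ℂ] H z := RingCon.mkₐ ℂ (ringConGen (HeckeRel z))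

/-- The algebra map `U𝔤 → H_z`. -/
def inU (z : U) : U →ₐ[ℂ] H z := (mkH z).comp Semidirect.inU

/-- The linear map `V → H_z`. -/
def inV (z : U) : V →ₗ[ℂ] H z :=
  (mkH z).toLinearMap ∘ₗ Semidirect.inV

/-- The element `x` of `H_z`: the highest weight vector of `V`. -/
def x (z : U) : H z := inV z ![1, 0]

/-- The element `y` of `H_z`; thus `[e, y] = x`. -/
def y (z : U) : H z := inV z ![0, 1]

/-- The algebra filtration of `H_z` in which `U𝔤` has degree `0` and `V` has degree `1`: the `n`-th
term is spanned by the products `u₀ v₁ u₁ ⋯ vₖ uₖ` with `k ≤ n`, `uᵢ ∈ U𝔤` and `vᵢ ∈ V`. -/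
def filtration (z : U) (n : ℕ) : Submodule ℂ (H z) :=
  ⨆ k ∈ Finset.range (n + 1),
    (inU z).toLinearMap.range * ((inV z).range * (inU z).toLinearMap.range) ^ k

/-- `a` has filtration degree exactly `n`. -/
def HasFiltrationDegree (z : U) (a : H z) (n : ℕ) : Prop :=
  IsLeast {m : ℕ | a ∈ filtration z m} n

/-- The commutator `[a, b] = ab - ba`. -/
def bracket {R : Type*} [Ring R] (a b : R) : R := a * b - b * a

/-- `ω = p(Δ)` satisfies the equation `[x, ω] = ¼ ([Δz - z, x] + z [Δ, x] - Δ [z, x])` in `H_z`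
that determines `ω_z` up to an additive constant. -/
def IsOmega (z : U) (p : ℂ[X]) : Prop :=
  bracket (x z) (inU z (aeval casimir p)) =
    (1 / 4 : ℂ) • (bracket (inU z (casimir * z - z)) (x z)
      + inU z z * bracket (inU z casimir) (x z) - inU z casimir * bracket (inU z z) (x z))

/-- The element `t_z = ey² + hxy - fx² - ½hz - ω_z` of `H_z`, with `ω_z = p(Δ)`. -/
def t (z : U) (p : ℂ[X]) : H z :=
  inU z (toU e) * y z ^ 2 + inU z (toU h) * x z * y z - inU z (toU f) * x z ^ 2
    - (1 / 2 : ℂ) • inU z (toU h * z) - inU z (aeval casimir p)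

end InfHecke

end

/-!
The proof rests on a faithful representation of `H_z` on functions on the lattice `ℤ²` with values
in `ℂ[X]`, on which `h` and `Δ` are diagonal and `t_z` is multiplication by the variable `X`.

Write `Δ + 1 = s²`. Since `V ⊗ V_λ = V_{λ+1} ⊕ V_{λ-1}`, the element `x` is a sum of a part that
raises `s` by one and a part that lowers it by one (`casimir_comm_casimir_comm_x`). So `x` acts on
delta functions by `δ_s ↦ δ_{s+1} + g(s) δ_{s-1}`, and the relation `[x, y] = z` becomes the
recursion `(s + 1) g(s + 1) - (s - 1) g(s) = z(s)`. The equation for `ω_z` is what makes `g = -(X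
+ ω - (1 - s) z / 2) / (s (s - 1))` a solution (`downCoeff_rec`); its constant of integration `X`
is the value of `t_z` (`rep_t`).

In the algebra generated by `ad Δ`, left and right multiplication by `Δ` on `x` are the
polynomials `((ad Δ ± 1)/2)² - 1`. This turns the equation for `ω_z` into an identity between odd
polynomials (`OmegaIdentity`), which is solvable by comparing degrees
(`exists_comp_sub_comp_of_odd`). It needs `z ∈ ℂ[Δ]`, that is, the description of the center of
`U𝔤` (`exists_eq_aeval_casimir`).

For faithfulness, `t_z` is central by a direct computation (`t_mem_center`), and `e y²` can be
expressed through `t_z`, so the monomials `tᵐ hᵇ fᵃ eᶜ yⁱ xʲ` with `c = 0` or `i ≤ 1` span `H_z`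
(`span_reducedMonomial`). They act linearly independently, because their leading terms, first with
respect to the shift of `s` and then with respect to the degree in `s`, are distinct
(`eq_zero_of_sum_reducedOp_delta`). No PBW theorem is assumed; it comes out of this argument.

A central element commutes with `h` and `Δ`, whose joint eigenvalues on the delta functions are
distinct, so it acts diagonally. Its diagonal entries lie in `ℂ[X]`, and they all agree because it
commutes with `e` and `x`, which connect the lattice. Hence it acts by some `P(X)`, as `P(t_z)`
does, and is `P(t_z)` by faithfulness (`exists_eq_aeval_t`). The remaining claims are read off as
well: `X` is transcendental, and elements of filtration degree at most `1` have constant diagonal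
entries.
-/

noncomputable section

namespace InfHecke

/-! ### Relations in `U𝔤` -/

attribute [local instance] LieRing.ofAssociativeRing

theorem toU_lie (A B : 𝔤) : toU ⁅A, B⁆ = toU A * toU B - toU B * toU A := by
  simp only [toU, LieHom.map_lie, LieRing.of_associative_ring_bracket]

theorem lie_e_f : ⁅e, f⁆ = h := by
  apply Subtype.ext
  rw [LieAlgebra.SpecialLinear.sl_bracket]
  ext i j
  fin_cases i <;> fin_cases j <;> simp [e, f, h]

theorem lie_h_e : ⁅h, e⁆ = (2 : ℂ) • e := by
  apply Subtype.ext
  rw [LieAlgebra.SpecialLinear.sl_bracket]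
  ext i j
  fin_cases i <;> fin_cases j <;> simp [e, h, Matrix.mul_apply, Matrix.single_apply]
  norm_num

theorem lie_h_f : ⁅h, f⁆ = (-2 : ℂ) • f := by
  apply Subtype.ext
  rw [LieAlgebra.SpecialLinear.sl_bracket]
  ext i j
  fin_cases i <;> fin_cases j <;> simp [f, h, Matrix.mul_apply, Matrix.single_apply]
  norm_num

theorem toU_smul (c : ℂ) (A : 𝔤) : toU (c • A) = c • toU A := by
  simp only [toU, map_smul]

theorem toU_add (A B : 𝔤) : toU (A + B) = toU A + toU B := by
  simp only [toU, map_add]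

theorem toU_e_mul_f : toU e * toU f = toU f * toU e + toU h := by
  rw [← lie_e_f, toU_lie]; abel

theorem toU_h_mul_e : toU h * toU e = toU e * toU h + 2 * toU e := by
  have := toU_lie h e
  rw [lie_h_e, toU_smul, ofNat_smul_eq_nsmul, nsmul_eq_mul] at this
  push_cast at this
  rw [this]; abel

theorem toU_h_mul_f : toU h * toU f = toU f * toU h - 2 * toU f := by
  have := toU_lie h f
  rw [lie_h_f, toU_smul, neg_smul, ofNat_smul_eq_nsmul, nsmul_eq_mul] at this
  push_cast at this
  rw [sub_eq_add_neg, this]; abel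

theorem val_one_one (A : 𝔤) : A.val 1 1 = -A.val 0 0 := by
  have htr : Matrix.trace A.val = 0 := A.2
  rw [Matrix.trace_fin_two] at htr
  linear_combination htr

theorem eq_combination (A : 𝔤) :
    A = A.val 0 1 • e + A.val 1 0 • f + A.val 0 0 • h := by
  apply Subtype.ext
  ext i j
  fin_cases i <;> fin_cases j <;> simp [e, f, h]
  exact val_one_one A

/-- `U𝔤` is generated by `𝔤`: a subalgebra containing `e`, `f`, `h` is everything. -/
theorem mem_of_generators (S : Subalgebra ℂ U) (he : toU e ∈ S) (hf : toU f ∈ S) (hh : toU h ∈ S)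
    (u : U) : u ∈ S := by
  have hg : ∀ A : 𝔤, toU A ∈ S := fun A => by
    rw [eq_combination A, toU_add, toU_add, toU_smul, toU_smul, toU_smul]
    exact S.add_mem (S.add_mem (S.smul_mem he _) (S.smul_mem hf _)) (S.smul_mem hh _)
  let φ : 𝔤 →ₗ⁅ℂ⁆ S :=
    { toFun := fun A => ⟨toU A, hg A⟩
      map_add' := fun A B => Subtype.ext (toU_add A B)
      map_smul' := fun c A => Subtype.ext (toU_smul c A)
      map_lie' := fun {A B} => Subtype.ext (toU_lie A B) }
  have key : S.val.comp (UniversalEnvelopingAlgebra.lift ℂ φ) = AlgHom.id ℂ U := by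
    apply UniversalEnvelopingAlgebra.hom_ext
    apply LieHom.ext
    intro A
    change (UniversalEnvelopingAlgebra.lift ℂ φ (UniversalEnvelopingAlgebra.ι ℂ A) : U) = _
    rw [UniversalEnvelopingAlgebra.lift_ι_apply]
    rfl
  have := congrArg (fun ψ : U →ₐ[ℂ] U => ψ u) key
  simp only [AlgHom.comp_apply, AlgHom.id_apply] at this
  rw [← this]
  exact (UniversalEnvelopingAlgebra.lift ℂ φ u).2

theorem casimir_comm (u : U) : casimir * u = u * casimir := by
  have key : ∀ v : U, v ∈ Subalgebra.centralizer ℂ {casimir} ↔ casimir * v = v * casimir := by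
    intro v; simp [Subalgebra.mem_centralizer_iff]
  have h1 := toU_e_mul_f
  have h2 := toU_h_mul_e
  have h3 := toU_h_mul_f
  rw [← key]
  apply mem_of_generators <;> rw [key] <;> unfold casimir
  · linear_combination (norm := noncomm_ring) toU h * h2 + h2 * toU h - 4 * toU e * h1
  · linear_combination (norm := noncomm_ring) toU h * h3 + h3 * toU h + 4 * h1 * toU f
  · linear_combination (norm := noncomm_ring) -4 * toU e * h3 - 4 * h2 * toU f

/-! ### Relations in `H_z` -/

section

variable (z : U)

theorem inU_mul_inV (A : 𝔤) (v : V) :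
    inU z (toU A) * inV z v = inV z (A.val *ᵥ v) + inV z v * inU z (toU A) := by
  have := congrArg (mkH z) (Semidirect.mk_rel (SemidirectRel.act A v))
  rw [map_mul, map_add, map_mul] at this
  exact this

theorem x_mul_y : x z * y z = y z * x z + inU z z := by
  have : mkH z (Semidirect.inV ![1, 0] * Semidirect.inV ![0, 1]) =
      mkH z (Semidirect.inV ![0, 1] * Semidirect.inV ![1, 0] + Semidirect.inU z) :=
    Quotient.sound (RingCon.le_ringConGen _ _ HeckeRel.comm)
  rw [map_mul, map_add, map_mul] at this
  exact this

theorem inV_eq (v : V) : inV z v = v 0 • x z + v 1 • y z := by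
  have : v = v 0 • ![1, 0] + v 1 • ![0, 1] := by
    ext i; fin_cases i <;> simp
  conv_lhs => rw [this]
  simp only [map_add, map_smul, x, y]

theorem e_mul_x : inU z (toU e) * x z = x z * inU z (toU e) := by
  rw [x, inU_mul_inV, inV_eq]
  simp [e, Matrix.mulVec, dotProduct, Matrix.single_apply]

theorem e_mul_y : inU z (toU e) * y z = y z * inU z (toU e) + x z := by
  rw [y, inU_mul_inV, inV_eq]
  simp [e, Matrix.mulVec, dotProduct, Matrix.single_apply, add_comm]

theorem f_mul_x : inU z (toU f) * x z = x z * inU z (toU f) + y z := by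
  rw [x, inU_mul_inV, inV_eq]
  simp [f, Matrix.mulVec, dotProduct, Matrix.single_apply, add_comm]

theorem f_mul_y : inU z (toU f) * y z = y z * inU z (toU f) := by
  rw [y, inU_mul_inV, inV_eq]
  simp [f, Matrix.mulVec, dotProduct, Matrix.single_apply]

theorem h_mul_x : inU z (toU h) * x z = x z * inU z (toU h) + x z := by
  rw [x, inU_mul_inV, inV_eq]
  simp [h, Matrix.mulVec, dotProduct, Matrix.single_apply, add_comm, x]

theorem h_mul_y : inU z (toU h) * y z = y z * inU z (toU h) - y z := by
  rw [y, inU_mul_inV, inV_eq]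
  simp [h, Matrix.mulVec, dotProduct, Matrix.single_apply, y]
  abel

/-- `H_z` is generated by `U𝔤` and `V`. -/
theorem eq_top_of_mul_mem (S : Submodule ℂ (H z)) (h1 : 1 ∈ S)
    (hU : ∀ u, ∀ a ∈ S, inU z u * a ∈ S) (hx : ∀ a ∈ S, x z * a ∈ S) (hy : ∀ a ∈ S, y z * a ∈ S) :
    S = ⊤ := by
  have hV : ∀ v, ∀ a ∈ S, inV z v * a ∈ S := fun v a ha => by
    rw [inV_eq, add_mul, smul_mul_assoc, smul_mul_assoc]
    exact S.add_mem (S.smul_mem _ (hx a ha)) (S.smul_mem _ (hy a ha))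
  have key : ∀ w : TensorAlgebra ℂ (U × V), ∀ a ∈ S, mkH z (Semidirect.mk w) * a ∈ S := by
    intro w
    induction w using TensorAlgebra.induction with
    | algebraMap r =>
      intro a ha
      rw [AlgHom.commutes, AlgHom.commutes, ← Algebra.smul_def]
      exact S.smul_mem _ ha
    | ι p =>
      intro a ha
      have : p = (p.1, (0 : V)) + ((0 : U), p.2) := by simp
      rw [this, map_add, map_add, map_add, add_mul]
      exact S.add_mem (hU p.1 a ha) (hV p.2 a ha)
    | mul v w hv hw =>
      intro a ha
      rw [map_mul, map_mul, mul_assoc]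
      exact hv _ (hw _ ha)
    | add v w hv hw =>
      intro a ha
      rw [map_add, map_add, add_mul]
      exact S.add_mem (hv _ ha) (hw _ ha)
  rw [Submodule.eq_top_iff']
  intro a
  obtain ⟨b, rfl⟩ := RingCon.mkₐ_surjective (α := ℂ) (ringConGen (HeckeRel z)) a
  obtain ⟨w, rfl⟩ := RingCon.mkₐ_surjective (α := ℂ) (ringConGen SemidirectRel) b
  have := key w 1 h1
  rw [mul_one] at this
  exact this

end

/-! ### Centrality of `t_z` -/

section

variable (z : U)

theorem ofNat_mul_eq_smul (n : ℕ) [n.AtLeastTwo] (a : H z) :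
    (OfNat.ofNat n : H z) * a = (OfNat.ofNat n : ℂ) • a := by
  rw [Algebra.smul_def, map_ofNat]

/-- The coefficient `4 e y` of `t_z` in terms of `[Δ, x]`, which the equation for `ω_z` involves. -/
theorem four_e_mul_y : 4 * (inU z (toU e) * y z) =
    inU z casimir * x z - x z * inU z casimir - 2 * (inU z (toU h) * x z) + 3 * x z := by
  have hc : inU z casimir = inU z (toU h) * inU z (toU h) + 4 * (inU z (toU e) * inU z (toU f))
      - 2 * inU z (toU h) := by
    simp only [casimir, map_add, map_sub, map_mul, map_ofNat, sq]
  have hex := e_mul_x z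
  have hfx := f_mul_x z
  have hhx := h_mul_x z
  rw [hc]
  linear_combination (norm := noncomm_ring) -inU z (toU h) * hhx - hhx * inU z (toU h) + 3 * hhx
    - 4 * inU z (toU e) * hfx - 4 * hex * inU z (toU f)

/-- The double commutator of `Δ` with `x`; it expresses that `V ⊗ V_λ = V_{λ+1} ⊕ V_{λ-1}`. -/
theorem casimir_comm_casimir_comm_x :
    inU z casimir * (inU z casimir * x z - x z * inU z casimir)
      - (inU z casimir * x z - x z * inU z casimir) * inU z casimir =
    2 * (inU z casimir * x z + x z * inU z casimir) + 3 * x z := by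
  have hc : inU z casimir = inU z (toU h) * inU z (toU h) + 4 * (inU z (toU e) * inU z (toU f))
      - 2 * inU z (toU h) := by
    simp only [casimir, map_add, map_sub, map_mul, map_ofNat, sq]
  have hey := e_mul_y z
  have hfx := f_mul_x z
  have hfy := f_mul_y z
  have hhy := h_mul_y z
  have h4 := four_e_mul_y z
  have hhe := congrArg (inU z) toU_h_mul_e
  simp only [map_add, map_mul, map_ofNat] at hhe
  have hce : inU z casimir * inU z (toU e) = inU z (toU e) * inU z casimir := by
    rw [← map_mul, casimir_comm, map_mul]
  have hch : inU z casimir * inU z (toU h) = inU z (toU h) * inU z casimir := by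
    rw [← map_mul, casimir_comm, map_mul]
  have hcy : inU z casimir * y z - y z * inU z casimir =
      4 * (inU z (toU f) * x z) - 2 * (inU z (toU h) * y z) - 3 * y z := by
    rw [hc]
    linear_combination (norm := noncomm_ring) inU z (toU h) * hhy + hhy * inU z (toU h) - hhy
      + 4 * inU z (toU e) * hfy + 4 * hey * inU z (toU f) - 4 * hfx
  have hD : inU z casimir * x z - x z * inU z casimir =
      4 * (inU z (toU e) * y z) + 2 * (inU z (toU h) * x z) - 3 * x z := by
    rw [h4]; abel
  linear_combination (norm := noncomm_ring) inU z casimir * hD - hD * inU z casimir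
    + 4 * hce * y z + 2 * hch * x z + 4 * inU z (toU e) * hcy + 2 * inU z (toU h) * hD - 3 * hD
    + 2 * hD - 4 * hc * x z + 8 * hhe * y z

/-- `t_z` multiplied out: the relation that eliminates the product `e y²`. -/
theorem e_mul_y_sq (p : ℂ[X]) : inU z (toU e) * y z ^ 2 =
    t z p - inU z (toU h) * (x z * y z) + inU z (toU f) * x z ^ 2
      + inU z ((1 / 2 : ℂ) • (toU h * z) + aeval casimir p) := by
  rw [t, map_add, map_smul, mul_assoc (inU z (toU h))]
  abel

variable {z}

theorem IsOmega.four_mul {p : ℂ[X]} (hp : IsOmega z p) :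
    4 * (x z * inU z (aeval casimir p) - inU z (aeval casimir p) * x z) =
      inU z z * (inU z casimir * x z - x z * inU z casimir)
        + (inU z casimir * x z - x z * inU z casimir) * inU z z
        - (inU z z * x z - x z * inU z z) := by
  have h4 : ∀ a b : H z, a = (1 / 4 : ℂ) • b → 4 * a = b := by
    rintro a b rfl
    rw [ofNat_mul_eq_smul, smul_smul]
    norm_num
  have := h4 _ _ hp
  simp only [bracket, map_sub, map_mul] at this
  rw [this]
  noncomm_ring

theorem inU_comm_of_center {w : U} (hw : w ∈ Subalgebra.center ℂ U) (u : U) :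
    inU z u * inU z w = inU z w * inU z u := by
  rw [← map_mul, Subalgebra.mem_center_iff.1 hw u, map_mul]

theorem aeval_casimir_mem_center (p : ℂ[X]) : aeval casimir p ∈ Subalgebra.center ℂ U := by
  have : casimir ∈ Subalgebra.center ℂ U :=
    Subalgebra.mem_center_iff.2 fun u => (casimir_comm u).symm
  exact Algebra.adjoin_le (Set.singleton_subset_iff.2 this) (aeval_mem_adjoin_singleton ℂ _)

/-- `t_z` commutes with `x` by the equation for `ω_z`, it is `ad 𝔤`-invariant by construction, and
`y = [f, x]`; hence it is central. -/
theorem t_mem_center (hz : z ∈ Subalgebra.center ℂ U) {p : ℂ[X]} (hp : IsOmega z p) :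
    t z p ∈ Subalgebra.center ℂ (H z) := by
  have hω := hp.four_mul
  have hc := aeval_casimir_mem_center p
  have hex := e_mul_x z
  have hey := e_mul_y z
  have hfx := f_mul_x z
  have hfy := f_mul_y z
  have hhx := h_mul_x z
  have hhy := h_mul_y z
  have hxy := x_mul_y z
  have h4 := four_e_mul_y z
  have hef := congrArg (inU z) toU_e_mul_f
  have hhe := congrArg (inU z) toU_h_mul_e
  have hhf := congrArg (inU z) toU_h_mul_f
  simp only [map_add, map_sub, map_mul, map_ofNat] at hef hhe hhf
  have hez := inU_comm_of_center (z := z) hz (toU e)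
  have hfz := inU_comm_of_center (z := z) hz (toU f)
  have hhz := inU_comm_of_center (z := z) hz (toU h)
  have hew := inU_comm_of_center (z := z) hc (toU e)
  have hfw := inU_comm_of_center (z := z) hc (toU f)
  have hhw := inU_comm_of_center (z := z) hc (toU h)
  have ht : 4 * t z p = 4 * (inU z (toU e) * y z * y z + inU z (toU h) * x z * y z
      - inU z (toU f) * x z * x z) - 2 * (inU z (toU h) * inU z z)
      - 4 * inU z (aeval casimir p) := by
    have h2 : 4 * ((1 / 2 : ℂ) • inU z (toU h * z)) = 2 * (inU z (toU h) * inU z z) := by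
      rw [← map_mul, ofNat_mul_eq_smul, ofNat_mul_eq_smul, smul_smul]
      norm_num
    rw [← h2, t]
    noncomm_ring
  have cancel : ∀ a : H z, a * (4 * t z p) = 4 * t z p * a → a * t z p = t z p * a := by
    intro a ha
    rw [ofNat_mul_eq_smul, mul_smul_comm, smul_mul_assoc] at ha
    exact smul_right_injective (H z) (by norm_num : (4 : ℂ) ≠ 0) ha
  have hx : x z * t z p = t z p * x z := by
    apply cancel
    rw [ht]
    linear_combination (norm := noncomm_ring) -4 * hex * y z * y z + 4 * inU z (toU e) * hxy * y z
      + 4 * inU z (toU e) * y z * hxy - 4 * hhx * x z * y z + 4 * inU z (toU h) * x z * hxy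
      + 4 * hfx * x z * x z - 4 * x z * hxy - 4 * hxy * x z + 2 * hhx * inU z z
      + 4 * hez * y z + inU z z * h4 + h4 * inU z z - hω + 2 * hhz * x z
  have he : inU z (toU e) * t z p = t z p * inU z (toU e) := by
    apply cancel
    rw [ht]
    linear_combination (norm := noncomm_ring) 4 * inU z (toU e) * hey * y z
      + 4 * inU z (toU e) * y z * hey - 4 * hhe * x z * y z + 4 * inU z (toU h) * hex * y z
      + 4 * inU z (toU h) * x z * hey - 4 * hef * x z * x z - 4 * inU z (toU f) * hex * x z
      - 4 * inU z (toU f) * x z * hex + 2 * hhe * inU z z - 2 * inU z (toU h) * hez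
      - 4 * hew - 4 * inU z (toU e) * hxy
  have hf : inU z (toU f) * t z p = t z p * inU z (toU f) := by
    apply cancel
    rw [ht]
    linear_combination (norm := noncomm_ring) -4 * hef * y z * y z
      + 4 * inU z (toU e) * hfy * y z + 4 * inU z (toU e) * y z * hfy
      - 4 * hhf * x z * y z + 4 * inU z (toU h) * hfx * y z
      + 4 * inU z (toU h) * x z * hfy - 4 * inU z (toU f) * hfx * x z
      - 4 * inU z (toU f) * x z * hfx + 2 * hhf * inU z z - 2 * inU z (toU h) * hfz
      - 4 * hfw + 4 * inU z (toU f) * hxy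
  have hh : inU z (toU h) * t z p = t z p * inU z (toU h) := by
    apply cancel
    rw [ht]
    linear_combination (norm := noncomm_ring) 4 * hhe * y z * y z
      + 4 * inU z (toU e) * hhy * y z + 4 * inU z (toU e) * y z * hhy
      + 4 * inU z (toU h) * hhx * y z
      + 4 * inU z (toU h) * x z * hhy - 4 * hhf * x z * x z - 4 * inU z (toU f) * hhx * x z
      - 4 * inU z (toU f) * x z * hhx - 2 * inU z (toU h) * hhz
      - 4 * hhw
  have hy : y z * t z p = t z p * y z := by
    linear_combination (norm := noncomm_ring) hf * x z + inU z (toU f) * hx - hx * inU z (toU f)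
      - x z * hf - hfx * t z p + t z p * hfx
  have hU : ∀ u, inU z u * t z p = t z p * inU z u := by
    let S : Subalgebra ℂ U := (Subalgebra.centralizer ℂ {t z p}).comap (inU z)
    have hS : ∀ u, u ∈ S ↔ inU z u * t z p = t z p * inU z u := fun u => by
      simp [S, Subalgebra.mem_centralizer_iff, eq_comm]
    exact fun u => (hS u).1 (mem_of_generators S ((hS _).2 he) ((hS _).2 hf) ((hS _).2 hh) u)
  have htop := eq_top_of_mul_mem z (Subalgebra.toSubmodule (Subalgebra.centralizer ℂ {t z p}))
  simp only [Subalgebra.mem_toSubmodule, Subalgebra.mem_centralizer_iff, Set.mem_singleton_iff,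
    forall_eq] at htop
  have := htop (by simp)
    (fun u a ha => by rw [← mul_assoc, ← hU, mul_assoc, ha, mul_assoc])
    (fun a ha => by rw [← mul_assoc, ← hx, mul_assoc, ha, mul_assoc])
    (fun a ha => by rw [← mul_assoc, ← hy, mul_assoc, ha, mul_assoc])
  rw [Subalgebra.mem_center_iff]
  intro a
  have ha : a ∈ Subalgebra.toSubmodule (Subalgebra.centralizer ℂ {t z p}) := by
    rw [this]; trivial
  simpa [Subalgebra.mem_centralizer_iff, eq_comm] using ha

end

/-! ### Spanning sets -/

/-- The ordered monomials span `U𝔤`; this is the easy half of the Poincaré–Birkhoff–Witt theorem. -/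
theorem span_ordered_monomials_U :
    Submodule.span ℂ (Set.range fun n : ℕ × ℕ × ℕ =>
      toU h ^ n.1 * (toU f ^ n.2.1 * toU e ^ n.2.2)) = ⊤ := by
  set S := Submodule.span ℂ (Set.range fun n : ℕ × ℕ × ℕ =>
      toU h ^ n.1 * (toU f ^ n.2.1 * toU e ^ n.2.2))
  have hmem : ∀ b a c, toU h ^ b * (toU f ^ a * toU e ^ c) ∈ S := fun b a c =>
    Submodule.subset_span ⟨(b, a, c), rfl⟩
  have closed : ∀ g : U, (∀ b a c, g * (toU h ^ b * (toU f ^ a * toU e ^ c)) ∈ S) →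
      ∀ s ∈ S, g * s ∈ S := by
    intro g hg s hs
    induction hs using Submodule.span_induction with
    | mem s hs => obtain ⟨⟨b, a, c⟩, rfl⟩ := hs; exact hg b a c
    | zero => simp
    | add s s' _ _ hs hs' => rw [mul_add]; exact S.add_mem hs hs'
    | smul r s _ hs => rw [mul_smul_comm]; exact S.smul_mem r hs
  have hh : ∀ s ∈ S, toU h * s ∈ S := closed _ fun b a c => by
    rw [← mul_assoc, ← pow_succ']; exact hmem _ _ _
  have hf : ∀ s ∈ S, toU f * s ∈ S := closed _ fun b a c => by
    induction b with
    | zero => simpa [← mul_assoc, ← pow_succ'] using hmem 0 (a + 1) c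
    | succ b ih =>
      have : toU f * (toU h ^ (b + 1) * (toU f ^ a * toU e ^ c)) =
          toU h * (toU f * (toU h ^ b * (toU f ^ a * toU e ^ c))) +
          (2 : ℂ) • (toU f * (toU h ^ b * (toU f ^ a * toU e ^ c))) := by
        rw [two_smul, pow_succ']
        linear_combination (norm := noncomm_ring)
          -toU_h_mul_f * (toU h ^ b * (toU f ^ a * toU e ^ c))
      rw [this]
      exact S.add_mem (hh _ ih) (S.smul_mem _ ih)
  have he : ∀ s ∈ S, toU e * s ∈ S := closed _ fun b a c => by
    induction b with
    | zero =>
      rw [pow_zero, one_mul]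
      induction a with
      | zero => simpa [← pow_succ'] using hmem 0 0 (c + 1)
      | succ a ih =>
        have : toU e * (toU f ^ (a + 1) * toU e ^ c) =
            toU f * (toU e * (toU f ^ a * toU e ^ c)) + toU h * (toU f ^ a * toU e ^ c) := by
          rw [pow_succ']
          linear_combination (norm := noncomm_ring) toU_e_mul_f * (toU f ^ a * toU e ^ c)
        rw [this]
        exact S.add_mem (hf _ ih) (by simpa using hmem 1 a c)
    | succ b ih =>
      have : toU e * (toU h ^ (b + 1) * (toU f ^ a * toU e ^ c)) =
          toU h * (toU e * (toU h ^ b * (toU f ^ a * toU e ^ c))) -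
          (2 : ℂ) • (toU e * (toU h ^ b * (toU f ^ a * toU e ^ c))) := by
        rw [two_smul, pow_succ']
        linear_combination (norm := noncomm_ring)
          -toU_h_mul_e * (toU h ^ b * (toU f ^ a * toU e ^ c))
      rw [this]
      exact S.sub_mem (hh _ ih) (S.smul_mem _ ih)
  let T : Subalgebra ℂ U :=
    { carrier := {u | ∀ s ∈ S, u * s ∈ S}
      mul_mem' := fun {u v} hu hv s hs => by rw [mul_assoc]; exact hu _ (hv _ hs)
      add_mem' := fun {u v} hu hv s hs => by rw [add_mul]; exact S.add_mem (hu _ hs) (hv _ hs)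
      algebraMap_mem' := fun r s hs => by rw [← Algebra.smul_def]; exact S.smul_mem r hs }
  rw [Submodule.eq_top_iff']
  intro u
  have := mem_of_generators T he hf hh u 1 (by simpa using hmem 0 0 0)
  rwa [mul_one] at this

section

variable (z : U)

/-- The span of the elements `u yⁱ xʲ` with `u ∈ U𝔤` and `i + j < n`. -/
def orderedSpan (n : ℕ) : Submodule ℂ (H z) :=
  Submodule.span ℂ {a | ∃ u i j, i + j < n ∧ a = inU z u * (y z ^ i * x z ^ j)}

variable {z}

theorem mem_orderedSpan {n i j : ℕ} (hij : i + j < n) (u : U) :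
    inU z u * (y z ^ i * x z ^ j) ∈ orderedSpan z n :=
  Submodule.subset_span ⟨u, i, j, hij, rfl⟩

theorem mul_mem_of_span_orderedSpan {n : ℕ} {S : Submodule ℂ (H z)} (g : H z)
    (hg : ∀ u i j, i + j < n → g * (inU z u * (y z ^ i * x z ^ j)) ∈ S)
    {a : H z} (ha : a ∈ orderedSpan z n) : g * a ∈ S := by
  induction ha using Submodule.span_induction with
  | mem s hs => obtain ⟨u, i, j, hij, rfl⟩ := hs; exact hg u i j hij
  | zero => simp
  | add s s' _ _ hs hs' => rw [mul_add]; exact S.add_mem hs hs'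
  | smul r s _ hs => rw [mul_smul_comm]; exact S.smul_mem r hs

theorem orderedSpan_mono {m n : ℕ} (hmn : m ≤ n) : orderedSpan z m ≤ orderedSpan z n := by
  apply Submodule.span_mono
  rintro _ ⟨u, i, j, hij, rfl⟩
  exact ⟨u, i, j, hij.trans_le hmn, rfl⟩

theorem inU_mul_mem_orderedSpan {n : ℕ} (u : U) {a : H z} (ha : a ∈ orderedSpan z n) :
    inU z u * a ∈ orderedSpan z n :=
  mul_mem_of_span_orderedSpan _ (fun v i j hij => by
    rw [← mul_assoc, ← map_mul]; exact mem_orderedSpan hij _) ha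

/-- `V · U𝔤 ⊆ U𝔤 · V`. -/
theorem exists_inV_mul_inU (u : U) (v : V) :
    ∃ u₁ u₂, inV z v * inU z u = inU z u₁ * x z + inU z u₂ * y z := by
  let T : Subalgebra ℂ U :=
    { carrier := {u | ∀ v, ∃ u₁ u₂, inV z v * inU z u = inU z u₁ * x z + inU z u₂ * y z}
      mul_mem' := fun {a b} ha hb v => by
        obtain ⟨a₁, a₂, ha⟩ := ha v
        obtain ⟨b₁, b₂, hb₁⟩ := hb ![1, 0]
        obtain ⟨b₃, b₄, hb₂⟩ := hb ![0, 1]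
        refine ⟨a₁ * b₁ + a₂ * b₃, a₁ * b₂ + a₂ * b₄, ?_⟩
        rw [← x] at hb₁
        rw [← y] at hb₂
        simp only [map_mul, map_add]
        linear_combination (norm := noncomm_ring) ha * inU z b + inU z a₁ * hb₁ + inU z a₂ * hb₂
      add_mem' := fun {a b} ha hb v => by
        obtain ⟨a₁, a₂, ha⟩ := ha v
        obtain ⟨b₁, b₂, hb⟩ := hb v
        refine ⟨a₁ + b₁, a₂ + b₂, ?_⟩
        simp only [map_add, mul_add, ha, hb]
        noncomm_ring
      algebraMap_mem' := fun r v => by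
        refine ⟨algebraMap ℂ U (r * v 0), algebraMap ℂ U (r * v 1), ?_⟩
        rw [inV_eq]
        rw [AlgHom.commutes, ← Algebra.commutes]
        simp only [AlgHom.commutes, map_mul, Algebra.smul_def, mul_add, mul_assoc] }
  have hT : ∀ A : 𝔤, toU A ∈ T := fun A v => by
    refine ⟨v 0 • toU A - (A.val *ᵥ v) 0 • 1, v 1 • toU A - (A.val *ᵥ v) 1 • 1, ?_⟩
    have h1 := inU_mul_inV z A v
    have h2 := inV_eq z (A.val *ᵥ v)
    rw [h2, inV_eq z v] at h1
    rw [inV_eq z v, ← sub_eq_iff_eq_add'.2 h1]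
    simp only [map_sub, map_smul, map_one, mul_add, sub_mul, mul_smul_comm, smul_mul_assoc, one_mul]
    abel
  exact mem_of_generators T (hT e) (hT f) (hT h) u v

theorem inV_mul_mem_orderedSpan_of {n : ℕ}
    (hx : ∀ i j, i + j < n → x z * (y z ^ i * x z ^ j) ∈ orderedSpan z (n + 1))
    (v : V) {a : H z} (ha : a ∈ orderedSpan z n) : inV z v * a ∈ orderedSpan z (n + 1) := by
  refine mul_mem_of_span_orderedSpan _ (fun u i j hij => ?_) ha
  obtain ⟨u₁, u₂, hu⟩ := exists_inV_mul_inU (z := z) u v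
  rw [← mul_assoc, hu, add_mul, mul_assoc, mul_assoc]
  refine Submodule.add_mem _ (inU_mul_mem_orderedSpan _ (hx i j hij)) ?_
  rw [← mul_assoc (y z), ← pow_succ']
  exact mem_orderedSpan (by omega) _

/-- `x` and `y` commute up to terms of lower degree. -/
theorem x_mul_sub_mem_orderedSpan (n : ℕ) : ∀ i j, i + j = n →
    x z * (y z ^ i * x z ^ j) - y z ^ i * x z ^ (j + 1) ∈ orderedSpan z n := by
  induction n using Nat.strong_induction_on with
  | _ n ih =>
    intro i j hij
    have hV : ∀ m < n, ∀ v, ∀ a ∈ orderedSpan z m, inV z v * a ∈ orderedSpan z (m + 1) := by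
      intro m hm v a ha
      refine inV_mul_mem_orderedSpan_of (fun i j hij => ?_) v ha
      have h1 := orderedSpan_mono (by omega : i + j ≤ m + 1) (ih (i + j) (by omega) i j rfl)
      have h2 := mem_orderedSpan (z := z) (by omega : i + (j + 1) < m + 1) 1
      rw [map_one, one_mul] at h2
      simpa using Submodule.add_mem _ h1 h2
    cases i with
    | zero => simp [← pow_succ']
    | succ i =>
      have h1 := hV (i + j) (by omega) ![0, 1] _ (ih (i + j) (by omega) i j rfl)
      have h2 := mem_orderedSpan (z := z) (by omega : i + j < n) z
      rw [show i + j + 1 = n by omega, ← y] at h1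
      have : x z * (y z ^ (i + 1) * x z ^ j) - y z ^ (i + 1) * x z ^ (j + 1) =
          y z * (x z * (y z ^ i * x z ^ j) - y z ^ i * x z ^ (j + 1)) +
            inU z z * (y z ^ i * x z ^ j) := by
        rw [pow_succ' (y z) i]
        linear_combination (norm := noncomm_ring) x_mul_y z * (y z ^ i * x z ^ j)
      rw [this]
      exact Submodule.add_mem _ h1 h2

theorem inV_mul_mem_orderedSpan {n : ℕ} (v : V) {a : H z} (ha : a ∈ orderedSpan z n) :
    inV z v * a ∈ orderedSpan z (n + 1) := by
  refine inV_mul_mem_orderedSpan_of (fun i j hij => ?_) v ha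
  have h1 := orderedSpan_mono (by omega : i + j ≤ n + 1)
    (x_mul_sub_mem_orderedSpan (z := z) (i + j) i j rfl)
  have h2 := mem_orderedSpan (z := z) (by omega : i + (j + 1) < n + 1) 1
  rw [map_one, one_mul] at h2
  simpa using Submodule.add_mem _ h1 h2

theorem exists_mem_orderedSpan (a : H z) : ∃ n, a ∈ orderedSpan z n := by
  have hdir : Monotone (orderedSpan z) := fun m n hmn => orderedSpan_mono hmn
  have hmem : ∀ a, a ∈ (⨆ n, orderedSpan z n) ↔ ∃ n, a ∈ orderedSpan z n := fun a =>
    Submodule.mem_iSup_of_directed _ hdir.directed_le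
  rw [← hmem, eq_top_of_mul_mem z (⨆ n, orderedSpan z n)]
  · trivial
  · rw [hmem]
    exact ⟨1, by simpa using mem_orderedSpan (z := z) (i := 0) (j := 0) zero_lt_one 1⟩
  · simp only [hmem]
    rintro u a ⟨n, ha⟩
    exact ⟨n, inU_mul_mem_orderedSpan u ha⟩
  · simp only [hmem]
    rintro a ⟨n, ha⟩
    exact ⟨n + 1, inV_mul_mem_orderedSpan _ ha⟩
  · simp only [hmem]
    rintro a ⟨n, ha⟩
    exact ⟨n + 1, inV_mul_mem_orderedSpan _ ha⟩

/-- Exponents of the reduced monomials `tᵐ hᵇ fᵃ eᶜ yⁱ xʲ`: those not divisible by `e y²`, which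
`t` replaces. -/
@[ext]
structure ReducedExponent where
  /-- The exponent of `t`. -/
  m : ℕ
  /-- The exponent of `h`. -/
  b : ℕ
  /-- The exponent of `f`. -/
  a : ℕ
  /-- The exponent of `e`. -/
  c : ℕ
  /-- The exponent of `y`. -/
  i : ℕ
  /-- The exponent of `x`. -/
  j : ℕ
  /-- The monomial is not divisible by `e y²`. -/
  reduced : c = 0 ∨ i ≤ 1

/-- The reduced monomial `tᵐ hᵇ fᵃ eᶜ yⁱ xʲ` in `H_z`. -/
def reducedMonomial (z : U) (p : ℂ[X]) (n : ReducedExponent) : H z :=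
  t z p ^ n.m * (inU z (toU h ^ n.b * (toU f ^ n.a * toU e ^ n.c)) * (y z ^ n.i * x z ^ n.j))

/-- The reduced monomials span `H_z`, since `e y²` equals `t - hxy + fx²` up to terms of lower
degree. -/
theorem span_reducedMonomial (hz : z ∈ Subalgebra.center ℂ U) {p : ℂ[X]} (hp : IsOmega z p) :
    Submodule.span ℂ (Set.range (reducedMonomial z p)) = ⊤ := by
  set S := Submodule.span ℂ (Set.range (reducedMonomial z p)) with hS
  have htc : ∀ a, a * t z p = t z p * a := Subalgebra.mem_center_iff.1 (t_mem_center hz hp)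
  have ht : ∀ s ∈ S, t z p * s ∈ S := by
    intro s hs
    induction hs using Submodule.span_induction with
    | mem s hs =>
      obtain ⟨n, rfl⟩ := hs
      rw [reducedMonomial, ← mul_assoc, ← pow_succ']
      exact Submodule.subset_span ⟨⟨n.m + 1, n.b, n.a, n.c, n.i, n.j, n.reduced⟩, rfl⟩
    | zero => simp
    | add s s' _ _ hs hs' => rw [mul_add]; exact S.add_mem hs hs'
    | smul r s _ hs => rw [mul_smul_comm]; exact S.smul_mem r hs
  have key : ∀ n, orderedSpan z n ≤ S := by
    intro n
    induction n with
    | zero =>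
      rw [orderedSpan, Submodule.span_le]
      rintro _ ⟨u, i, j, hij, rfl⟩
      omega
    | succ n ih =>
      have step : ∀ i, ∀ u j, i + j = n → inU z u * (y z ^ i * x z ^ j) ∈ S := by
        intro i
        induction i using Nat.strong_induction_on with
        | _ i ihi =>
          intro u j hij
          have hu : u ∈ Submodule.span ℂ (Set.range fun n : ℕ × ℕ × ℕ =>
              toU h ^ n.1 * (toU f ^ n.2.1 * toU e ^ n.2.2)) := by
            rw [span_ordered_monomials_U]; trivial
          induction hu using Submodule.span_induction with
          | zero => simp
          | add s s' _ _ hs hs' => rw [map_add, add_mul]; exact S.add_mem hs hs'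
          | smul r s _ hs => rw [map_smul, smul_mul_assoc]; exact S.smul_mem r hs
          | mem s hs =>
            obtain ⟨⟨b, a, c⟩, rfl⟩ := hs
            by_cases hred : c = 0 ∨ i ≤ 1
            · refine Submodule.subset_span ⟨⟨0, b, a, c, i, j, hred⟩, ?_⟩
              simp [reducedMonomial]
            obtain ⟨c, rfl⟩ : ∃ c', c = c' + 1 := ⟨c - 1, by omega⟩
            obtain ⟨i, rfl⟩ : ∃ i', i = i' + 2 := ⟨i - 2, by omega⟩
            set w : U := toU h ^ b * (toU f ^ a * toU e ^ c)
            set q : H z := y z ^ i * x z ^ j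
            have hy2 : y z ^ (i + 2) * x z ^ j = y z ^ 2 * q := by
              rw [← mul_assoc, ← pow_add, add_comm]
            have hw : inU z (toU h ^ b * (toU f ^ a * toU e ^ (c + 1))) =
                inU z w * inU z (toU e) := by
              rw [← map_mul, pow_succ]; simp only [w, mul_assoc]
            have hxyq : x z * (y z * q) - y z ^ (i + 1) * x z ^ (j + 1) ∈ orderedSpan z n := by
              have := x_mul_sub_mem_orderedSpan (z := z) (i + 1 + j) (i + 1) j rfl
              rw [pow_succ', mul_assoc] at this
              rw [pow_succ']
              exact orderedSpan_mono (by omega) this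
            have hxxq : x z * (x z * q) - y z ^ i * x z ^ (j + 2) ∈ orderedSpan z n := by
              have h1 := inV_mul_mem_orderedSpan ![1, 0]
                (x_mul_sub_mem_orderedSpan (z := z) (i + j) i j rfl)
              have h2 := x_mul_sub_mem_orderedSpan (z := z) (i + (j + 1)) i (j + 1) rfl
              have h3 := Submodule.add_mem _ (orderedSpan_mono (by omega : _ ≤ n) h1)
                (orderedSpan_mono (by omega : _ ≤ n) h2)
              rwa [← x, mul_sub, sub_add_sub_cancel] at h3
            have e1 := ht _ (ih (mem_orderedSpan (z := z) (by omega : i + j < n) w))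
            have e2 := S.add_mem
              (ih (inU_mul_mem_orderedSpan (w * toU h) hxyq))
              (ihi (i + 1) (by omega) (w * toU h) (j + 1) (by omega))
            have e3 := S.add_mem
              (ih (inU_mul_mem_orderedSpan (w * toU f) hxxq))
              (ihi i (by omega) (w * toU f) (j + 2) (by omega))
            have e4 := ih (mem_orderedSpan (z := z) (by omega : i + j < n)
              (w * ((1 / 2 : ℂ) • (toU h * z) + aeval casimir p)))
            rw [← mul_add, sub_add_cancel, map_mul] at e2 e3
            rw [map_mul] at e4
            rw [hy2, hw]
            convert S.add_mem (S.add_mem (S.sub_mem e1 e2) e3) e4 using 1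
            linear_combination (norm := noncomm_ring) inU z w * e_mul_y_sq z p * q +
              htc (inU z w) * q
      rw [orderedSpan, Submodule.span_le]
      rintro _ ⟨u, i, j, hij, rfl⟩
      rcases Nat.lt_succ_iff_lt_or_eq.1 hij with h1 | h1
      · exact ih (mem_orderedSpan h1 u)
      · exact step i u j h1
  rw [Submodule.eq_top_iff']
  intro a
  obtain ⟨n, hn⟩ := exists_mem_orderedSpan a
  exact key n hn

end

/-! ### The equation for `ω_z` -/

/-- Left multiplication by `Δ`, on the span of the `Δᵐ x Δⁿ`, as a polynomial in `ad Δ`. -/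
def leftPoly : ℂ[X] := C (1 / 4) * (X + 1) ^ 2 - 1

/-- Right multiplication by `Δ`, on the span of the `Δᵐ x Δⁿ`, as a polynomial in `ad Δ`. -/
def rightPoly : ℂ[X] := C (1 / 4) * (X - 1) ^ 2 - 1

/-- The equation between `ω = p(Δ)` and `z = q(Δ)`, read as an identity between the polynomials in
`ad Δ` that are applied to `x`. -/
def OmegaIdentity (q p : ℂ[X]) : Prop :=
  p.comp rightPoly - p.comp leftPoly =
    C (1 / 4) * ((q.comp leftPoly + q.comp rightPoly) * X
      - (q.comp leftPoly - q.comp rightPoly))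

theorem leftPoly_comp_neg : leftPoly.comp (-X) = rightPoly := by
  simp only [leftPoly, rightPoly, sub_comp, mul_comp, C_comp, pow_comp, add_comp, X_comp, one_comp]
  ring

theorem rightPoly_comp_neg : rightPoly.comp (-X) = leftPoly := by
  simp only [leftPoly, rightPoly, sub_comp, mul_comp, C_comp, pow_comp, X_comp, one_comp]
  ring

theorem leftPoly_sub_rightPoly : leftPoly - rightPoly = X := by
  have h4 : (C (1 / 4) : ℂ[X]) * 4 = 1 := by
    rw [← C_ofNat, ← C_mul]; norm_num
  simp only [leftPoly, rightPoly]
  linear_combination X * h4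

theorem natDegree_leftPoly_le : leftPoly.natDegree ≤ 2 := by
  unfold leftPoly; compute_degree

theorem natDegree_rightPoly_le : rightPoly.natDegree ≤ 2 := by
  unfold rightPoly; compute_degree

theorem coeff_leftPoly : leftPoly.coeff 2 = 1 / 4 := by
  unfold leftPoly
  rw [show C (1 / 4) * (X + 1) ^ 2 - 1 = C (1 / 4) * X ^ 2 + C (1 / 4) * (C 2 * X) +
    C (1 / 4) - (C 1 : ℂ[X]) by simp only [C_ofNat, C_1]; ring]
  simp [coeff_one]

theorem coeff_rightPoly : rightPoly.coeff 2 = 1 / 4 := by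
  rw [← sub_eq_iff_eq_add'.2 (sub_eq_iff_eq_add.1 leftPoly_sub_rightPoly), coeff_sub,
    coeff_leftPoly]
  simp [coeff_X]

theorem coeff_comp_neg_X (R : ℂ[X]) (n : ℕ) : (R.comp (-X)).coeff n = R.coeff n * (-1) ^ n := by
  rw [show (-X : ℂ[X]) = C (-1) * X by simp, comp_C_mul_X_coeff]

/-- Every odd polynomial is of the form `p(R) - p(L)`: the polynomials `Rⁿ⁺¹ - Lⁿ⁺¹` are odd of
degree `2n + 1`. -/
theorem exists_comp_sub_comp_of_odd (n : ℕ) : ∀ R : ℂ[X], R.comp (-X) = -R → R.natDegree ≤ 2 * n →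
    ∃ p : ℂ[X], p.comp rightPoly - p.comp leftPoly = R := by
  have heven : ∀ R : ℂ[X], R.comp (-X) = -R → ∀ k, R.coeff (2 * k) = 0 := by
    intro R hR k
    have h2 : R.coeff (2 * k) = - R.coeff (2 * k) := by
      have := coeff_comp_neg_X R (2 * k)
      rw [hR, coeff_neg, pow_mul] at this
      simpa using this.symm
    exact self_eq_neg.1 h2
  induction n with
  | zero =>
    intro R hR hd
    refine ⟨0, ?_⟩
    rw [eq_C_of_natDegree_eq_zero (by omega : R.natDegree = 0), heven R hR 0]
    simp
  | succ n ih =>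
    intro R hR hd
    set Q : ℂ[X] := (X ^ (n + 1)).comp rightPoly - (X ^ (n + 1)).comp leftPoly with hQ
    have hQ' : Q = -(X * ∑ i ∈ Finset.range (n + 1), leftPoly ^ i * rightPoly ^ (n - i)) := by
      have := (Commute.all leftPoly rightPoly).geom_sum₂_mul (n + 1)
      rw [leftPoly_sub_rightPoly] at this
      simp only [hQ, X_pow_comp]
      simp only [Nat.add_sub_cancel] at this
      linear_combination this
    have hterm : ∀ i ∈ Finset.range (n + 1),
        (leftPoly ^ i * rightPoly ^ (n - i)).natDegree ≤ 2 * n ∧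
        (leftPoly ^ i * rightPoly ^ (n - i)).coeff (2 * n) = (1 / 4) ^ n := by
      intro i hi
      have hi' : i ≤ n := by simpa [Nat.lt_succ_iff] using hi
      have d1 : (leftPoly ^ i).natDegree ≤ i * 2 := natDegree_pow_le_of_le i natDegree_leftPoly_le
      have d2 : (rightPoly ^ (n - i)).natDegree ≤ (n - i) * 2 :=
        natDegree_pow_le_of_le _ natDegree_rightPoly_le
      have hn : 2 * n = i * 2 + (n - i) * 2 := by omega
      refine ⟨natDegree_mul_le.trans (by omega), ?_⟩
      rw [hn, coeff_mul_add_eq_of_natDegree_le d1 d2,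
        coeff_pow_of_natDegree_le natDegree_leftPoly_le,
        coeff_pow_of_natDegree_le natDegree_rightPoly_le, coeff_leftPoly, coeff_rightPoly,
        ← pow_add]
      congr 1; omega
    have hQd : Q.natDegree ≤ 2 * n + 1 := by
      rw [hQ', natDegree_neg]
      refine natDegree_mul_le.trans ?_
      have := natDegree_sum_le_of_forall_le (Finset.range (n + 1)) _ (fun i hi => (hterm i hi).1)
      rw [natDegree_X]; omega
    have hQc : Q.coeff (2 * n + 1) ≠ 0 := by
      rw [hQ', coeff_neg, coeff_X_mul, finsetSum_coeff, Finset.sum_congr rfl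
        (fun i hi => (hterm i hi).2)]
      simp
      exact_mod_cast Nat.succ_ne_zero n
    have hQodd : Q.comp (-X) = -Q := by
      simp only [hQ, sub_comp, pow_comp, X_comp, leftPoly_comp_neg, rightPoly_comp_neg]
      ring
    set r : ℂ := R.coeff (2 * n + 1) / Q.coeff (2 * n + 1)
    have hodd' : (R - C r * Q).comp (-X) = -(R - C r * Q) := by
      simp only [sub_comp, mul_comp, C_comp, hQodd, hR]
      ring
    obtain ⟨p, hp⟩ := ih (R - C r * Q) hodd' (by
      rw [natDegree_le_iff_coeff_eq_zero]
      intro N hN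
      rcases Nat.lt_or_ge (2 * n + 2) N with h1 | h1
      · rw [coeff_sub, coeff_C_mul, coeff_eq_zero_of_natDegree_lt (by omega),
          coeff_eq_zero_of_natDegree_lt (by omega)]
        simp
      · obtain rfl | rfl : N = 2 * n + 1 ∨ N = 2 * (n + 1) := by omega
        · rw [coeff_sub, coeff_C_mul, div_mul_cancel₀ _ hQc, sub_self]
        · exact heven _ hodd' _)
    refine ⟨p + C r * X ^ (n + 1), ?_⟩
    simp only [add_comp, mul_comp, C_comp]
    linear_combination hp + C r * hQ.symm

theorem exists_omegaIdentity (q : ℂ[X]) : ∃ p, OmegaIdentity q p := by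
  refine exists_comp_sub_comp_of_odd _ _ ?_ (Nat.le_mul_of_pos_left _ two_pos)
  simp only [mul_comp, sub_comp, add_comp, C_comp, X_comp, comp_assoc, leftPoly_comp_neg,
    rightPoly_comp_neg]
  ring

theorem aeval_apply_eq_of_commute {M : Type*} [AddCommGroup M] [Module ℂ M]
    {φ ψ : Module.End ℂ M} (hc : Commute φ ψ) {v : M} (hv : φ v = ψ v) (p : ℂ[X]) :
    aeval φ p v = aeval ψ p v := by
  have hpow : ∀ n : ℕ, (φ ^ n) v = (ψ ^ n) v := by
    intro n
    induction n with
    | zero => rfl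
    | succ n ih =>
      rw [pow_succ', Module.End.mul_apply, ih, ← Module.End.mul_apply, (hc.pow_right n).eq,
        Module.End.mul_apply, hv, ← Module.End.mul_apply, ← pow_succ]
  simp only [aeval_eq_sum_range, LinearMap.sum_apply, LinearMap.smul_apply, hpow]

section

variable {A : Type*} [Ring A] [Algebra ℂ A]

theorem aeval_mulLeft (c : A) (p : ℂ[X]) (a : A) :
    aeval (LinearMap.mulLeft ℂ c) p a = aeval c p * a := by
  simp only [aeval_eq_sum_range, LinearMap.sum_apply, LinearMap.smul_apply,
    LinearMap.pow_mulLeft, LinearMap.mulLeft_apply, Finset.sum_mul, smul_mul_assoc]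

theorem aeval_mulRight (c : A) (p : ℂ[X]) (a : A) :
    aeval (LinearMap.mulRight ℂ c) p a = a * aeval c p := by
  simp only [aeval_eq_sum_range, LinearMap.sum_apply, LinearMap.smul_apply,
    LinearMap.pow_mulRight, LinearMap.mulRight_apply, Finset.mul_sum, mul_smul_comm]

/-- The commutator with `c`, as a linear map. -/
def commutatorMap (c : A) : Module.End ℂ A := LinearMap.mulLeft ℂ c - LinearMap.mulRight ℂ c

theorem commutatorMap_apply (c a : A) : commutatorMap c a = c * a - a * c := rfl

theorem commute_mulLeft_commutatorMap (c : A) :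
    Commute (LinearMap.mulLeft ℂ c) (commutatorMap c) :=
  (Commute.refl _).sub_right (LinearMap.commute_mulLeft_right c c)

theorem commute_mulRight_commutatorMap (c : A) :
    Commute (LinearMap.mulRight ℂ c) (commutatorMap c) :=
  (LinearMap.commute_mulLeft_right c c).symm.sub_right (Commute.refl _)

theorem commute_aeval_right {B : Type*} [Ring B] [Algebra ℂ B] {a b : B} (hab : Commute a b)
    (p : ℂ[X]) : Commute a (aeval b p) := by
  rw [aeval_eq_sum_range]
  exact Commute.sum_right _ _ _ fun i _ => (hab.pow_right i).smul_right _

theorem quarter_smul_mul (a : A) : (1 / 4 : ℂ) • (4 * a) = a := by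
  rw [← map_ofNat (algebraMap ℂ A) 4, ← Algebra.smul_def, smul_smul]
  norm_num

/-- The relation of `casimir_comm_casimir_comm_x` expresses left multiplication by `c` on `v`
through `ad c`. -/
theorem aeval_mul_eq {c v : A}
    (hv : c * (c * v - v * c) - (c * v - v * c) * c = 2 * (c * v + v * c) + 3 * v) (p : ℂ[X]) :
    aeval c p * v = aeval (commutatorMap c) (p.comp leftPoly) v := by
  rw [aeval_comp, ← aeval_mulLeft]
  refine aeval_apply_eq_of_commute (commute_aeval_right (commute_mulLeft_commutatorMap c) _) ?_ p
  simp only [leftPoly, map_sub, map_mul, aeval_C, map_add, aeval_X, map_one, sq,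
    ← Algebra.smul_def, LinearMap.sub_apply, LinearMap.smul_apply, Module.End.mul_apply,
    LinearMap.add_apply, Module.End.one_apply, LinearMap.mulLeft_apply, commutatorMap_apply]
  rw [eq_sub_iff_add_eq, ← quarter_smul_mul (c * v + v)]
  congr 1
  linear_combination (norm := noncomm_ring) -hv

theorem mul_aeval_eq {c v : A}
    (hv : c * (c * v - v * c) - (c * v - v * c) * c = 2 * (c * v + v * c) + 3 * v) (p : ℂ[X]) :
    v * aeval c p = aeval (commutatorMap c) (p.comp rightPoly) v := by
  rw [aeval_comp, ← aeval_mulRight]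
  refine aeval_apply_eq_of_commute (commute_aeval_right (commute_mulRight_commutatorMap c) _) ?_ p
  simp only [rightPoly, map_sub, map_mul, aeval_C, aeval_X, map_one, sq,
    ← Algebra.smul_def, LinearMap.sub_apply, LinearMap.smul_apply, Module.End.mul_apply,
    Module.End.one_apply, LinearMap.mulRight_apply, commutatorMap_apply]
  rw [eq_sub_iff_add_eq, ← quarter_smul_mul (v * c + v)]
  congr 1
  linear_combination (norm := noncomm_ring) -hv

end

theorem isOmega_of_omegaIdentity {z : U} {q p : ℂ[X]} (hz : z = aeval casimir q)
    (hqp : OmegaIdentity q p) : IsOmega z p := by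
  set c : H z := inU z casimir with hc
  have hv := casimir_comm_casimir_comm_x z
  rw [← hc] at hv
  have hcz : c * inU z z = inU z z * c := by
    rw [hc, ← map_mul, ← map_mul, casimir_comm]
  have hzq : inU z z = aeval c q := by
    rw [hc, aeval_algHom_apply]; exact congrArg (inU z) hz
  have h2 : inU z z * (c * x z - x z * c) =
      aeval (commutatorMap c) (X * q.comp leftPoly) (x z) := by
    rw [map_mul, Module.End.mul_apply, ← aeval_mul_eq hv, aeval_X, commutatorMap_apply, ← hzq]
    linear_combination (norm := noncomm_ring) -hcz * x z
  have h3 : (c * x z - x z * c) * inU z z =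
      aeval (commutatorMap c) (X * q.comp rightPoly) (x z) := by
    rw [map_mul, Module.End.mul_apply, ← mul_aeval_eq hv, aeval_X, commutatorMap_apply, ← hzq]
    linear_combination (norm := noncomm_ring) -x z * hcz
  have h4 : bracket (inU z (casimir * z - z)) (x z) + inU z z * bracket c (x z)
      - c * bracket (inU z z) (x z) = inU z z * (c * x z - x z * c)
        + (c * x z - x z * c) * inU z z - (inU z z * x z - x z * inU z z) := by
    simp only [bracket, map_sub, map_mul, ← hc]
    noncomm_ring
  rw [IsOmega, h4, h2, h3, hzq, aeval_mul_eq hv, mul_aeval_eq hv, bracket, ← aeval_algHom_apply,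
    ← hc, mul_aeval_eq hv, aeval_mul_eq hv, ← LinearMap.sub_apply, ← LinearMap.sub_apply,
    ← LinearMap.add_apply, ← LinearMap.sub_apply, ← LinearMap.smul_apply, ← map_sub, hqp,
    ← map_sub, ← map_add, ← map_sub, ← map_smul, smul_eq_C_mul]
  congr 2
  ring

/-! ### A representation on functions on a lattice -/

/-- The space of functions `φ(l, k)` on `ℤ²` with values in `ℂ[X]`. On the delta function at `(l,
k)`, the element `h` acts by `2l + k`, the Casimir element `Δ` by `s² - 1` with `s = k + i`, and
the central element `t_z` by the variable `X`. The offset `i` keeps `s` away from all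
half-integers, so that no denominator vanishes and the eigenvalues of `(h, Δ)` are distinct. -/
abbrev LatticeFn : Type := ℤ → ℤ → ℂ[X]

/-- The spectral parameter `s = k + i`. -/
def spec (k : ℤ) : ℂ := k + Complex.I

theorem spec_add_ne_zero (k : ℤ) (c : ℝ) : spec k + c ≠ 0 := by
  intro h0
  have := congrArg Complex.im h0
  simp [spec] at this

theorem spec_sub_one_ne_zero (k : ℤ) : spec k - 1 ≠ 0 := by
  simpa [sub_eq_add_neg] using spec_add_ne_zero k (-1)

theorem spec_ne_zero (k : ℤ) : spec k ≠ 0 := by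
  simpa using spec_add_ne_zero k 0

theorem spec_injective : Function.Injective spec := fun k k' hk => by
  simpa [spec] using hk

theorem spec_sq_injective : Function.Injective fun k => spec k ^ 2 := by
  intro k k' hk
  rcases sq_eq_sq_iff_eq_or_eq_neg.1 hk with h1 | h1
  · exact spec_injective h1
  · have := congrArg Complex.im h1
    simp [spec] at this
    norm_num at this

/-- The operator by which `h` acts. -/
def opH : Module.End ℂ LatticeFn where
  toFun φ l k := C (2 * (l : ℂ) + k) * φ l k
  map_add' φ ψ := by funext l k; simp only [Pi.add_apply, mul_add]
  map_smul' r φ := by funext l k; simp only [Pi.smul_apply, RingHom.id_apply, mul_smul_comm]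

/-- The operator by which `e` acts. -/
def opE : Module.End ℂ LatticeFn where
  toFun φ l k := φ (l - 1) k
  map_add' _ _ := rfl
  map_smul' _ _ := rfl

/-- The operator by which `f` acts. -/
def opF : Module.End ℂ LatticeFn where
  toFun φ l k := C (1 / 4 * (spec k ^ 2 - (2 * l + k + 1) ^ 2)) * φ (l + 1) k
  map_add' φ ψ := by funext l k; simp only [Pi.add_apply, mul_add]
  map_smul' r φ := by funext l k; simp only [Pi.smul_apply, RingHom.id_apply, mul_smul_comm]

/-- The operator by which `x` acts: it shifts `s` up with coefficient `1`, and down with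
coefficient `g`. -/
def opX (g : ℤ → ℂ[X]) : Module.End ℂ LatticeFn where
  toFun φ l k := φ l (k - 1) + g (k + 1) * φ (l - 1) (k + 1)
  map_add' φ ψ := by funext l k; simp only [Pi.add_apply]; ring
  map_smul' r φ := by
    funext l k; simp only [Pi.smul_apply, RingHom.id_apply, mul_smul_comm, smul_add]

/-- The operator by which `y = [f, x]` acts. -/
def opY (g : ℤ → ℂ[X]) : Module.End ℂ LatticeFn where
  toFun φ l k := C (1 / 2 * (spec k - (2 * l + k + 1))) * φ (l + 1) (k - 1) +
    C (1 / 2 * (-spec k - (2 * l + k + 1))) * g (k + 1) * φ l (k + 1)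
  map_add' φ ψ := by funext l k; simp only [Pi.add_apply]; ring
  map_smul' r φ := by
    funext l k; simp only [Pi.smul_apply, RingHom.id_apply, mul_smul_comm, smul_add]

theorem opH_apply (φ : LatticeFn) (l k : ℤ) : opH φ l k = C (2 * (l : ℂ) + k) * φ l k := rfl

theorem opE_apply (φ : LatticeFn) (l k : ℤ) : opE φ l k = φ (l - 1) k := rfl

theorem opF_apply (φ : LatticeFn) (l k : ℤ) :
    opF φ l k = C (1 / 4 * (spec k ^ 2 - (2 * l + k + 1) ^ 2)) * φ (l + 1) k := rfl

theorem opX_apply (g : ℤ → ℂ[X]) (φ : LatticeFn) (l k : ℤ) :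
    opX g φ l k = φ l (k - 1) + g (k + 1) * φ (l - 1) (k + 1) := rfl

theorem opY_apply (g : ℤ → ℂ[X]) (φ : LatticeFn) (l k : ℤ) :
    opY g φ l k = C (1 / 2 * (spec k - (2 * l + k + 1))) * φ (l + 1) (k - 1) +
      C (1 / 2 * (-spec k - (2 * l + k + 1))) * g (k + 1) * φ l (k + 1) := rfl

theorem C_half_mul_two : (C (1 / 2) : ℂ[X]) * 2 = 1 := by
  rw [← C_ofNat, ← C_mul]; norm_num

theorem C_quarter_mul_four : (C (1 / 4) : ℂ[X]) * 4 = 1 := by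
  rw [← C_ofNat, ← C_mul]; norm_num

theorem C_quarter : (C (1 / 4) : ℂ[X]) = C (1 / 2) * C (1 / 2) := by
  rw [← C_mul]; norm_num

theorem opE_mul_opF : opE * opF = opF * opE + opH := by
  refine LinearMap.ext fun φ => funext fun l => funext fun k => ?_
  simp only [Module.End.mul_apply, LinearMap.add_apply, Pi.add_apply, opE_apply, opF_apply,
    opH_apply, sub_add_cancel, add_sub_cancel_right, spec]
  push_cast
  simp only [C_mul, C_sub, C_add, C_pow, C_ofNat, C_1, map_intCast]
  linear_combination (φ l k) * (2 * l + k) * C_quarter_mul_four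

theorem opH_mul_opE : opH * opE = opE * opH + (2 : ℂ) • opE := by
  refine LinearMap.ext fun φ => funext fun l => funext fun k => ?_
  simp only [Module.End.mul_apply, LinearMap.add_apply, Pi.add_apply, opE_apply,
    opH_apply, LinearMap.smul_apply, Pi.smul_apply, smul_eq_C_mul]
  push_cast
  simp only [C_mul, C_sub, C_add, C_ofNat, C_1, map_intCast]
  ring

theorem opH_mul_opF : opH * opF = opF * opH - (2 : ℂ) • opF := by
  refine LinearMap.ext fun φ => funext fun l => funext fun k => ?_
  simp only [Module.End.mul_apply, LinearMap.sub_apply, Pi.sub_apply, opF_apply,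
    opH_apply, LinearMap.smul_apply, Pi.smul_apply, smul_eq_C_mul]
  push_cast
  simp only [C_mul, C_sub, C_add, C_ofNat, C_1, map_intCast]
  ring

section

variable (g : ℤ → ℂ[X])

theorem opE_mul_opX : opE * opX g = opX g * opE := rfl

theorem opH_mul_opX : opH * opX g = opX g * opH + opX g := by
  refine LinearMap.ext fun φ => funext fun l => funext fun k => ?_
  simp only [Module.End.mul_apply, LinearMap.add_apply, Pi.add_apply, opX_apply, opH_apply]
  push_cast
  simp only [C_mul, C_sub, C_add, C_ofNat, C_1, map_intCast]
  ring

theorem opH_mul_opY : opH * opY g = opY g * opH - opY g := by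
  refine LinearMap.ext fun φ => funext fun l => funext fun k => ?_
  simp only [Module.End.mul_apply, LinearMap.sub_apply, Pi.sub_apply, opY_apply, opH_apply]
  push_cast
  simp only [C_mul, C_sub, C_add, C_ofNat, C_1, map_intCast]
  ring

theorem opE_mul_opY : opE * opY g = opY g * opE + opX g := by
  refine LinearMap.ext fun φ => funext fun l => funext fun k => ?_
  simp only [Module.End.mul_apply, LinearMap.add_apply, Pi.add_apply, opY_apply, opE_apply,
    opX_apply, sub_add_cancel, add_sub_cancel_right]
  push_cast
  simp only [C_mul, C_sub, C_add, C_neg, C_ofNat, C_1, map_intCast]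
  linear_combination (φ l (k - 1) + g (k + 1) * φ (l - 1) (k + 1)) * C_half_mul_two

theorem opF_mul_opX : opF * opX g = opX g * opF + opY g := by
  refine LinearMap.ext fun φ => funext fun l => funext fun k => ?_
  simp only [Module.End.mul_apply, LinearMap.add_apply, Pi.add_apply, opY_apply, opF_apply,
    opX_apply, sub_add_cancel, add_sub_cancel_right, spec, C_quarter, C_mul]
  push_cast
  simp only [C_mul, C_sub, C_add, C_neg, C_pow, C_ofNat, C_1, map_intCast]
  linear_combination C (1 / 2) * ((k + C Complex.I - (2 * l + k + 1)) * φ (l + 1) (k - 1) +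
    (-(k + C Complex.I) - (2 * l + k + 1)) * g (k + 1) * φ l (k + 1)) * C_half_mul_two

theorem opF_mul_opY : opF * opY g = opY g * opF := by
  refine LinearMap.ext fun φ => funext fun l => funext fun k => ?_
  simp only [Module.End.mul_apply, opY_apply, opF_apply, spec]
  push_cast
  simp only [C_mul, C_sub, C_add, C_neg, C_pow, C_ofNat, C_1, map_intCast]
  ring

/-- The recursion for `g` that makes `[x, y]` act by the function `ζ` of `s`. -/
theorem opX_mul_opY {ζ : ℤ → ℂ[X]}
    (hg : ∀ k, C (spec k + 1) * g (k + 1) - C (spec k - 1) * g k = ζ k) (φ : LatticeFn) (l k : ℤ) :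
    (opX g * opY g) φ l k = (opY g * opX g) φ l k + ζ k * φ l k := by
  rw [← hg]
  simp only [Module.End.mul_apply, opY_apply, opX_apply, sub_add_cancel, add_sub_cancel_right,
    spec]
  push_cast
  simp only [C_mul, C_sub, C_add, C_neg, C_ofNat, C_1, map_intCast]
  linear_combination ((k + C Complex.I + 1) * g (k + 1) - (k + C Complex.I - 1) * g k) * φ l k *
    C_half_mul_two

/-- The Lie algebra map by which `𝔤` acts. -/
def repLie : 𝔤 →ₗ⁅ℂ⁆ Module.End ℂ LatticeFn where
  toFun A := A.val 0 1 • opE + A.val 1 0 • opF + A.val 0 0 • opH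
  map_add' A B := by
    have hAB : ∀ i j, (A + B).val i j = A.val i j + B.val i j := fun _ _ => rfl
    simp only [hAB, add_smul]; abel
  map_smul' r A := by
    have hA : ∀ i j, (r • A).val i j = r * A.val i j := fun _ _ => rfl
    simp only [hA, smul_add, mul_smul, RingHom.id_apply]
  map_lie' := fun {A B} => by
    have hA : A.val 1 1 = -A.val 0 0 := val_one_one A
    have hB : B.val 1 1 = -B.val 0 0 := val_one_one B
    rw [LieAlgebra.SpecialLinear.sl_bracket, LieRing.of_associative_ring_bracket]
    simp only [Matrix.sub_apply, Matrix.mul_apply, Fin.sum_univ_two, hA, hB, mul_add, add_mul,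
      smul_mul_assoc, mul_smul_comm, opE_mul_opF, opH_mul_opE, opH_mul_opF]
    module

/-- The action of `U𝔤`. -/
def repU : U →ₐ[ℂ] Module.End ℂ LatticeFn := UniversalEnvelopingAlgebra.lift ℂ repLie

theorem repU_toU (A : 𝔤) :
    repU (toU A) = A.val 0 1 • opE + A.val 1 0 • opF + A.val 0 0 • opH :=
  UniversalEnvelopingAlgebra.lift_ι_apply ℂ repLie A

theorem repU_e : repU (toU e) = opE := by
  rw [repU_toU]; simp [e]

theorem repU_f : repU (toU f) = opF := by
  rw [repU_toU]; simp [f]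

theorem repU_h : repU (toU h) = opH := by
  rw [repU_toU]; simp [h]

/-- The action of `V`. -/
def repV : V →ₗ[ℂ] Module.End ℂ LatticeFn where
  toFun v := v 0 • opX g + v 1 • opY g
  map_add' v w := by simp only [Pi.add_apply, add_smul]; abel
  map_smul' r v := by
    simp only [Pi.smul_apply, smul_eq_mul, smul_add, mul_smul, RingHom.id_apply]

theorem repV_apply (v : V) : repV g v = v 0 • opX g + v 1 • opY g := rfl

/-- The action of the semidirect product `U𝔤 ⋉ TV`; it exists for every coefficient function `g`. -/
def repSemidirect : Semidirect →ₐ[ℂ] Module.End ℂ LatticeFn :=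
  RingCon.liftₐ _ (TensorAlgebra.lift ℂ (repU.toLinearMap.coprod (repV g))) <| by
    rw [RingCon.ringConGen_le]
    intro a b hab
    induction hab with
    | one => simp
    | mul a b => simp
    | act A v =>
      have hA : A.val 1 1 = -A.val 0 0 := val_one_one A
      rw [RingCon.ker_apply]
      change TensorAlgebra.lift ℂ (repU.toLinearMap.coprod (repV g)) _ =
        TensorAlgebra.lift ℂ (repU.toLinearMap.coprod (repV g)) _
      simp only [map_mul, map_add, TensorAlgebra.lift_ι_apply,
        LinearMap.coprod_apply, map_zero, zero_add, add_zero, AlgHom.toLinearMap_apply, repU_toU,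
        repV_apply, Matrix.mulVec, dotProduct, Fin.sum_univ_two, hA, mul_add, add_mul,
        smul_mul_assoc, mul_smul_comm, opE_mul_opX, opE_mul_opY, opF_mul_opX, opF_mul_opY,
        opH_mul_opX, opH_mul_opY]
      module

theorem repSemidirect_inU (u : U) : repSemidirect g (Semidirect.inU u) = repU u := by
  change TensorAlgebra.lift ℂ (repU.toLinearMap.coprod (repV g)) (TensorAlgebra.ι ℂ (u, 0)) = _
  simp

theorem repSemidirect_inV (v : V) : repSemidirect g (Semidirect.inV v) = repV g v := by
  change TensorAlgebra.lift ℂ (repU.toLinearMap.coprod (repV g)) (TensorAlgebra.ι ℂ (0, v)) = _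
  simp

end

theorem repU_casimir (φ : LatticeFn) (l k : ℤ) :
    repU casimir φ l k = C (spec k ^ 2 - 1) * φ l k := by
  simp only [casimir, map_add, map_sub, map_mul, map_pow, map_ofNat, repU_e, repU_f, repU_h]
  rw [← map_ofNat (algebraMap ℂ (Module.End ℂ LatticeFn)) 4,
    ← map_ofNat (algebraMap ℂ (Module.End ℂ LatticeFn)) 2, ← Algebra.smul_def, ← Algebra.smul_def]
  simp only [LinearMap.add_apply, LinearMap.sub_apply, LinearMap.smul_apply, Module.End.mul_apply,
    sq, Pi.add_apply, Pi.sub_apply, Pi.smul_apply, opE_apply, opF_apply, opH_apply, smul_eq_C_mul,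
    sub_add_cancel, spec]
  push_cast
  simp only [C_mul, C_sub, C_add, C_ofNat, C_1, map_intCast]
  linear_combination φ l k * ((k + C Complex.I) ^ 2 - (2 * l + k - 1) ^ 2) * C_quarter_mul_four

theorem repU_aeval_casimir (q : ℂ[X]) (φ : LatticeFn) (l k : ℤ) :
    repU (aeval casimir q) φ l k = C (q.eval (spec k ^ 2 - 1)) * φ l k := by
  induction q using Polynomial.induction_on' generalizing φ with
  | add p q hp hq =>
    simp only [map_add, LinearMap.add_apply, Pi.add_apply, hp, hq, eval_add, add_mul]
  | monomial n r =>
    rw [aeval_monomial, eval_monomial, ← Algebra.smul_def, map_smul, LinearMap.smul_apply,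
      Pi.smul_apply, Pi.smul_apply, smul_eq_C_mul, C_mul, mul_assoc]
    congr 1
    induction n generalizing φ with
    | zero => simp
    | succ n ih =>
      rw [pow_succ, map_mul, Module.End.mul_apply, ih, repU_casimir, pow_succ _ n, C_mul, mul_assoc]

/-- The coefficient `g` of the operator `x`, for `z = q(Δ)` and `ω = p(Δ)`: the solution
`-(X + ω - (1 - s) z / 2) / (s (s - 1))` of the recursion `(s + 1) g(s + 1) - (s - 1) g(s) = z`. -/
def downCoeff (q p : ℂ[X]) (k : ℤ) : ℂ[X] :=
  C (1 / (spec k * (spec k - 1))) *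
    (C (1 / 2 * (1 - spec k) * q.eval (spec k ^ 2 - 1) - p.eval (spec k ^ 2 - 1)) - X)

theorem mul_downCoeff (q p : ℂ[X]) (k : ℤ) :
    C (spec k) * C (spec k - 1) * downCoeff q p k =
      C (1 / 2 * (1 - spec k) * q.eval (spec k ^ 2 - 1) - p.eval (spec k ^ 2 - 1)) - X := by
  rw [downCoeff, ← C_mul, ← mul_assoc, ← C_mul, mul_one_div_cancel, C_1, one_mul]
  exact mul_ne_zero (spec_ne_zero k) (spec_sub_one_ne_zero k)

theorem OmegaIdentity.eval {q p : ℂ[X]} (hqp : OmegaIdentity q p) (s : ℂ) :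
    p.eval (s ^ 2 - 1) - p.eval ((s + 1) ^ 2 - 1) =
      1 / 2 * (s * q.eval ((s + 1) ^ 2 - 1) + (s + 1) * q.eval (s ^ 2 - 1)) := by
  have h1 := congrArg (Polynomial.eval (2 * s + 1)) hqp
  simp only [eval_sub, eval_comp, eval_mul, eval_add, eval_C, eval_X] at h1
  have hR : rightPoly.eval (2 * s + 1) = s ^ 2 - 1 := by
    simp [rightPoly]; ring
  have hL : leftPoly.eval (2 * s + 1) = (s + 1) ^ 2 - 1 := by
    simp [leftPoly]; ring
  rw [hR, hL] at h1
  rw [h1]; ring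

theorem spec_add_one (k : ℤ) : spec (k + 1) = spec k + 1 := by
  simp only [spec]; push_cast; ring

theorem downCoeff_rec {q p : ℂ[X]} (hqp : OmegaIdentity q p) (k : ℤ) :
    C (spec k + 1) * downCoeff q p (k + 1) - C (spec k - 1) * downCoeff q p k =
      C (q.eval (spec k ^ 2 - 1)) := by
  have h0 : (C (spec k) : ℂ[X]) ≠ 0 := C_ne_zero.2 (spec_ne_zero k)
  apply mul_left_cancel₀ h0
  have h1 := mul_downCoeff q p k
  have h2 := mul_downCoeff q p (k + 1)
  have h3 := congrArg (C : ℂ → ℂ[X]) (hqp.eval (spec k))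
  rw [spec_add_one] at h2
  simp only [C_mul, C_sub, C_add, C_1] at h1 h2 h3 ⊢
  linear_combination h2 - h1 + h3 + C (spec k) * C (eval (spec k ^ 2 - 1) q) * C_half_mul_two

section

variable {z : U} {q p : ℂ[X]}

/-- The representation of `H_z`, for `z = q(Δ)` and `ω_z = p(Δ)`, on which `t_z` acts by `X`. -/
def rep (hz : z = aeval casimir q) (hqp : OmegaIdentity q p) :
    H z →ₐ[ℂ] Module.End ℂ LatticeFn :=
  RingCon.liftₐ _ (repSemidirect (downCoeff q p)) <| by
    rw [RingCon.ringConGen_le]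
    intro a b hab
    induction hab with
    | comm =>
      rw [RingCon.ker_apply]
      change repSemidirect (downCoeff q p) _ = repSemidirect (downCoeff q p) _
      simp only [map_mul, map_add, repSemidirect_inV, repSemidirect_inU,
        repV_apply, Matrix.cons_val_zero, Matrix.cons_val_one, one_smul, zero_smul, add_zero,
        zero_add]
      refine LinearMap.ext fun φ => funext fun l => funext fun k => ?_
      rw [opX_mul_opY _ (downCoeff_rec hqp), LinearMap.add_apply, Pi.add_apply, Pi.add_apply, hz,
        repU_aeval_casimir]

variable (hz : z = aeval casimir q) (hqp : OmegaIdentity q p)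

theorem rep_inU (u : U) : rep hz hqp (inU z u) = repU u :=
  repSemidirect_inU (downCoeff q p) u

theorem rep_x : rep hz hqp (x z) = opX (downCoeff q p) := by
  refine (repSemidirect_inV (downCoeff q p) ![1, 0]).trans ?_
  simp [repV_apply]

theorem rep_y : rep hz hqp (y z) = opY (downCoeff q p) := by
  refine (repSemidirect_inV (downCoeff q p) ![0, 1]).trans ?_
  simp [repV_apply]

theorem rep_t (φ : LatticeFn) (l k : ℤ) : rep hz hqp (t z p) φ l k = X * φ l k := by
  have hc := repU_aeval_casimir q
  have h1 := mul_downCoeff q p k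
  have h2 := downCoeff_rec hqp k
  rw [← hz] at hc
  rw [t, sq (y z), sq (x z)]
  simp only [map_add, map_sub, map_mul, map_smul, rep_x, rep_y, rep_inU, repU_e, repU_f,
    repU_h, LinearMap.add_apply, LinearMap.sub_apply, LinearMap.smul_apply,
    Module.End.mul_apply, Pi.add_apply, Pi.sub_apply, Pi.smul_apply, smul_eq_C_mul, opE_apply,
    opF_apply, opH_apply, opX_apply, opY_apply, sub_add_cancel, add_sub_cancel_right,
    hc, repU_aeval_casimir]
  set g := downCoeff q p
  simp only [spec] at h1 h2 ⊢
  push_cast at h1 h2 ⊢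
  simp only [C_quarter, C_mul, C_sub, C_add, C_neg, C_pow, C_ofNat, C_1, map_intCast] at h1 h2 ⊢
  set s : ℂ[X] := k + C Complex.I with hs
  linear_combination -φ l k * h1 + C (1 / 2) * φ l k * (1 - s + (2 * l + k)) * h2
    + (C (1 / 2) * (1 - s) * (1 + s + (2 * l + k)) * g k * φ l k
      + C (1 / 2) * (1 + s) * (1 - s + (2 * l + k)) * g (k + 1) * φ l k
      - s * (s - 1) * g k * φ l k
      - (2 * l + k) * C (1 / 2) * ((s - 1 - (2 * l + k)) * φ (l + 1) (k - 1 - 1)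
        + (-s + 1 - (2 * l + k)) * g k * φ l k + g (k + 1) * ((s + 1 - (2 * l + k)) * φ l k
        + (-s - 1 - (2 * l + k)) * g (k + 1 + 1) * φ (l - 1) (k + 1 + 1)))) * C_half_mul_two

end

/-! ### Linear independence of the reduced monomials -/

/-- The delta function at `(l₀, k₀)`. -/
def delta (l₀ k₀ : ℤ) : LatticeFn := fun l k => if l = l₀ ∧ k = k₀ then 1 else 0

theorem delta_self (l k : ℤ) : delta l k l k = 1 := by simp [delta]

theorem delta_of_ne {l₀ k₀ l k : ℤ} (hne : ¬(l = l₀ ∧ k = k₀)) : delta l₀ k₀ l k = 0 := if_neg hne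

/-- `A` raises `k` by at most `N`, and its component that raises `k` by exactly `N` shifts `l` by
`w` and multiplies with `Q`, evaluated at the target. -/
def HasTop (A : Module.End ℂ LatticeFn) (N w : ℤ) (Q : ℤ → ℤ → ℂ[X]) : Prop :=
  ∀ (k₀ : ℤ) (φ : LatticeFn), (∀ l k, k₀ < k → φ l k = 0) →
    (∀ l k, k₀ + N < k → A φ l k = 0) ∧ ∀ l, A φ l (k₀ + N) = Q l (k₀ + N) * φ (l - w) k₀

theorem HasTop.mul {A B : Module.End ℂ LatticeFn} {N w N' w' : ℤ} {Q Q' : ℤ → ℤ → ℂ[X]}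
    (hA : HasTop A N w Q) (hB : HasTop B N' w' Q') :
    HasTop (A * B) (N + N') (w + w') (fun l k => Q l k * Q' (l - w) (k - N)) := by
  intro k₀ φ hφ
  obtain ⟨h1, h2⟩ := hB k₀ φ hφ
  obtain ⟨h3, h4⟩ := hA (k₀ + N') (B φ) h1
  refine ⟨fun l k hk => h3 l k (by omega), fun l => ?_⟩
  have e1 : k₀ + (N + N') = k₀ + N' + N := by ring
  have e2 : l - (w + w') = l - w - w' := by ring
  rw [Module.End.mul_apply, e1, h4, h2, e2]
  simp only [add_sub_cancel_right, mul_assoc]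

/-- The top component of `A` is given by a polynomial in `h` and `s` that, up to a nonzero scalar,
is monic of degree `D` in `s`. The inner variable of `ℂ[X][X]` stands for `h`, the outer for `s`. -/
def HasMonicTop (A : Module.End ℂ LatticeFn) (N w : ℤ) (D : ℕ) : Prop :=
  ∃ (r : ℂ) (P : ℂ[X][X]), r ≠ 0 ∧ P.Monic ∧ P.natDegree = D ∧
    HasTop A N w (fun l k => C (r * P.evalEval (2 * (l : ℂ) + k) (spec k)))

theorem evalEval_map_comp (P : ℂ[X][X]) (a b u v : ℂ) :
    ((P.map (compRingHom (X - C a))).comp (X - C (C b))).evalEval u v =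
      P.evalEval (u - a) (v - b) := by
  have h1 : eval (C (v - b)) (P.map (compRingHom (X - C a))) =
      compRingHom (X - C a) (eval (C (v - b)) P) := by
    rw [eval_map, ← eval₂_hom]
    simp
  simp only [evalEval, eval_comp, eval_sub, eval_X, eval_C, ← C_sub]
  rw [h1, coe_compRingHom_apply, eval_comp, eval_sub, eval_X, eval_C]

theorem HasMonicTop.mul {A B : Module.End ℂ LatticeFn} {N w N' w' : ℤ} {D D' : ℕ}
    (hA : HasMonicTop A N w D) (hB : HasMonicTop B N' w' D') :
    HasMonicTop (A * B) (N + N') (w + w') (D + D') := by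
  obtain ⟨r, P, hr, hP, hd, ht⟩ := hA
  obtain ⟨r', P', hr', hP', hd', ht'⟩ := hB
  set R := (P'.map (compRingHom (X - C (2 * (w : ℂ) + N)))).comp (X - C (C (N : ℂ)))
  have hR : R.Monic := (hP'.map _).comp_X_sub_C _
  refine ⟨r * r', P * R, mul_ne_zero hr hr', hP.mul hR, ?_, ?_⟩
  · rw [hP.natDegree_mul hR, hd, natDegree_comp, natDegree_X_sub_C, mul_one, hP'.natDegree_map, hd']
  · convert ht.mul ht' using 1
    funext l k
    rw [← C_mul, evalEval_mul, evalEval_map_comp]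
    congr 1
    have e1 : 2 * ((l - w : ℤ) : ℂ) + ((k - N : ℤ) : ℂ) = 2 * (l : ℂ) + k - (2 * w + N) := by
      push_cast; ring
    have e2 : spec (k - N) = spec k - N := by simp only [spec]; push_cast; ring
    rw [e1, e2]; ring

theorem hasMonicTop_one : HasMonicTop 1 0 0 0 := by
  refine ⟨1, 1, one_ne_zero, monic_one, natDegree_one,
    fun k₀ φ hφ => ⟨fun l k hk => ?_, fun l => ?_⟩⟩
  · exact hφ l k (by omega)
  · simp [evalEval]

theorem HasMonicTop.pow {A : Module.End ℂ LatticeFn} {N w : ℤ} {D : ℕ} (hA : HasMonicTop A N w D)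
    (n : ℕ) : HasMonicTop (A ^ n) (n * N) (n * w) (n * D) := by
  induction n with
  | zero => simpa using hasMonicTop_one
  | succ n ih =>
    have h1 := ih.mul hA
    rw [← pow_succ] at h1
    convert h1 using 1 <;> push_cast <;> ring

theorem hasMonicTop_opE : HasMonicTop opE 0 1 0 := by
  refine ⟨1, 1, one_ne_zero, monic_one, natDegree_one,
    fun k₀ φ hφ => ⟨fun l k hk => ?_, fun l => ?_⟩⟩
  · exact hφ _ k (by omega)
  · simp [evalEval, opE_apply]

theorem hasMonicTop_opF : HasMonicTop opF 0 (-1) 2 := by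
  refine ⟨1 / 4, X ^ 2 - C ((X + 1) ^ 2), by norm_num, monic_X_pow_sub_C _ two_ne_zero,
    natDegree_X_pow_sub_C, fun k₀ φ hφ => ⟨fun l k hk => ?_, fun l => ?_⟩⟩
  · rw [opF_apply, hφ _ k (by omega), mul_zero]
  · simp only [opF_apply, evalEval, eval_sub, eval_pow, eval_X, eval_C, eval_add, eval_one,
      add_zero, sub_neg_eq_add]

section

variable (g : ℤ → ℂ[X])

theorem hasMonicTop_opX : HasMonicTop (opX g) 1 0 0 := by
  refine ⟨1, 1, one_ne_zero, monic_one, natDegree_one,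
    fun k₀ φ hφ => ⟨fun l k hk => ?_, fun l => ?_⟩⟩
  · rw [opX_apply, hφ _ (k - 1) (by omega), hφ _ (k + 1) (by omega)]; simp
  · rw [opX_apply, hφ _ (k₀ + 1 + 1) (by omega)]; simp [evalEval]

theorem hasMonicTop_opY : HasMonicTop (opY g) 1 (-1) 1 := by
  refine ⟨1 / 2, X - C (X + 1), by norm_num, monic_X_sub_C _, natDegree_X_sub_C _,
    fun k₀ φ hφ => ⟨fun l k hk => ?_, fun l => ?_⟩⟩
  · rw [opY_apply, hφ _ (k - 1) (by omega), hφ _ (k + 1) (by omega)]; simp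
  · rw [opY_apply, hφ _ (k₀ + 1 + 1) (by omega)]
    simp only [evalEval, eval_sub, eval_X, eval_C, eval_add, eval_one, add_sub_cancel_right,
      sub_neg_eq_add, mul_zero, add_zero]

/-- The operator `fᵃ eᶜ yⁱ xʲ`. -/
def reducedOp (n : ReducedExponent) : Module.End ℂ LatticeFn :=
  opF ^ n.a * opE ^ n.c * (opY g ^ n.i * opX g ^ n.j)

theorem hasMonicTop_reducedOp (n : ReducedExponent) :
    HasMonicTop (reducedOp g n) (n.i + n.j) (n.c - n.a - n.i) (2 * n.a + n.i) := by
  unfold reducedOp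
  convert ((hasMonicTop_opF.pow n.a).mul (hasMonicTop_opE.pow n.c)).mul
    (((hasMonicTop_opY g).pow n.i).mul ((hasMonicTop_opX g).pow n.j)) using 1 <;> ring

theorem eq_zero_of_evalEval_lattice {R : ℂ[X][X]}
    (hR : ∀ l k : ℤ, R.evalEval (2 * (l : ℂ) + k) (spec k) = 0) : R = 0 := by
  have h1 : ∀ k : ℤ, R.IsRoot (C (spec k)) := fun k => by
    apply eq_zero_of_infinite_isRoot
    refine Set.infinite_of_injective_forall_mem (f := fun l : ℤ => 2 * (l : ℂ) + k) ?_ (hR · k)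
    intro l l' hl
    simpa using hl
  apply eq_zero_of_infinite_isRoot
  exact Set.infinite_of_injective_forall_mem (C_injective.comp spec_injective) h1

theorem ReducedExponent.eq_of_leading_eq {n n' : ReducedExponent}
    (hm : n.m = n'.m) (hb : n.b = n'.b)
    (hN : n.i + n.j = n'.i + n'.j) (hD : 2 * n.a + n.i = 2 * n'.a + n'.i)
    (hw : (n.c : ℤ) - n.a - n.i = n'.c - n'.a - n'.i) : n = n' := by
  have h1 := n.reduced
  have h2 := n'.reduced
  ext <;> omega

/-- The reduced monomials act linearly independently: their leading terms, with respect to first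
the shift of `k` and then the degree in `s`, are distinct. -/
theorem eq_zero_of_sum_reducedOp_delta (c : ReducedExponent →₀ ℂ)
    (hc : ∀ l₀ k₀ l k : ℤ, ∑ n ∈ c.support,
      C (c n * (2 * (l : ℂ) + k) ^ n.b) * X ^ n.m * reducedOp g n (delta l₀ k₀) l k = 0) :
    c = 0 := by
  classical
  by_contra hne
  obtain ⟨n₀, hn₀, hmax⟩ := Finset.exists_max_image c.support
    (fun n => toLex (n.i + n.j, 2 * n.a + n.i)) (Finsupp.support_nonempty_iff.2 hne)
  choose r P hr hP hd ht using hasMonicTop_reducedOp g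
  have hN : ∀ n ∈ c.support, n.i + n.j ≤ n₀.i + n₀.j := fun n hn => by
    rcases Prod.Lex.toLex_le_toLex.1 (hmax n hn) with h1 | h1
    · exact h1.le
    · exact h1.1.le
  have hD : ∀ n ∈ c.support, n.i + n.j = n₀.i + n₀.j → 2 * n.a + n.i ≤ 2 * n₀.a + n₀.i :=
    fun n hn h0 => by
      rcases Prod.Lex.toLex_le_toLex.1 (hmax n hn) with h1 | h1
      · exact absurd h0 h1.ne
      · exact h1.2
  let S : Finset ReducedExponent := c.support.filter fun n =>
    (n.i + n.j = n₀.i + n₀.j ∧ (n.c : ℤ) - n.a - n.i = n₀.c - n₀.a - n₀.i) ∧ n.m = n₀.m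
  let R : ℂ[X][X] := ∑ n ∈ S, C (C (c n * r n) * X ^ n.b) * P n
  have hR : R = 0 := by
    apply eq_zero_of_evalEval_lattice
    intro l k
    have key := hc (l - (n₀.c - n₀.a - n₀.i)) (k - (n₀.i + n₀.j)) l k
    have hterm : ∀ n ∈ c.support, C (c n * (2 * (l : ℂ) + k) ^ n.b) * X ^ n.m *
        reducedOp g n (delta (l - (n₀.c - n₀.a - n₀.i)) (k - (n₀.i + n₀.j))) l k =
        if n.i + n.j = n₀.i + n₀.j ∧ (n.c : ℤ) - n.a - n.i = n₀.c - n₀.a - n₀.i then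
          C (c n * r n * (2 * (l : ℂ) + k) ^ n.b * (P n).evalEval (2 * (l : ℂ) + k) (spec k)) *
            X ^ n.m else 0 := by
      intro n hn
      obtain ⟨h1, h2⟩ := ht n (k - (n₀.i + n₀.j)) (delta (l - (n₀.c - n₀.a - n₀.i))
        (k - (n₀.i + n₀.j))) (fun l' k' hk' => delta_of_ne (by omega))
      rcases (hN n hn).lt_or_eq with h3 | h3
      · rw [h1 l k (by omega), mul_zero, if_neg (by omega)]
      · have h4 := h2 l
        rw [show k - ((n₀.i : ℤ) + n₀.j) + (n.i + n.j) = k by omega] at h4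
        rw [h4]
        split_ifs with h5
        · rw [h5.2, delta_self]
          simp only [C_mul]
          ring
        · rw [delta_of_ne (by omega)]
          ring
    rw [Finset.sum_congr rfl hterm, ← Finset.sum_filter] at key
    have key2 := congrArg (fun p : ℂ[X] => p.coeff n₀.m) key
    simp only [finsetSum_coeff, coeff_C_mul, coeff_X_pow, mul_ite, mul_one, mul_zero, coeff_zero,
      eq_comm (a := n₀.m)] at key2
    rw [← Finset.sum_filter, Finset.filter_filter] at key2
    rw [← key2]
    simp only [R, evalEval, eval_finsetSum, eval_mul, eval_C, eval_pow, eval_X]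
    rfl
  have hcoeff := congrArg (fun p : ℂ[X][X] => (p.coeff (2 * n₀.a + n₀.i)).coeff n₀.b) hR
  have hS₀ : n₀ ∈ S := Finset.mem_filter.2 ⟨hn₀, ⟨rfl, rfl⟩, rfl⟩
  simp only [R, finsetSum_coeff, coeff_C_mul, coeff_zero] at hcoeff
  rw [Finset.sum_eq_single_of_mem n₀ hS₀] at hcoeff
  · have h1 : (P n₀).coeff (2 * n₀.a + n₀.i) = 1 := by rw [← hd n₀]; exact hP n₀
    rw [h1, mul_one, coeff_C_mul, coeff_X_pow_self, mul_one] at hcoeff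
    exact mul_ne_zero (Finsupp.mem_support_iff.1 hn₀) (hr n₀) hcoeff
  · intro n hn hnn
    obtain ⟨hn1, ⟨hn2, hn3⟩, hn4⟩ := Finset.mem_filter.1 hn
    rcases (hD n hn1 hn2).lt_or_eq with h1 | h1
    · rw [coeff_eq_zero_of_natDegree_lt (p := P n) (by rw [hd]; exact h1)]
      simp
    · have h2 : (P n).coeff (2 * n₀.a + n₀.i) = 1 := by rw [← h1, ← hd n]; exact hP n
      have h3 : n₀.b ≠ n.b := fun hb =>
        hnn (ReducedExponent.eq_of_leading_eq hn4 hb.symm hn2 h1 hn3)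
      rw [h2, mul_one, coeff_C_mul, coeff_X_pow, if_neg h3, mul_zero]

end

/-! ### The center of `U𝔤` -/

theorem opH_pow_apply (b : ℕ) (φ : LatticeFn) (l k : ℤ) :
    (opH ^ b) φ l k = C ((2 * (l : ℂ) + k) ^ b) * φ l k := by
  induction b generalizing φ with
  | zero => simp
  | succ b ih => rw [pow_succ, Module.End.mul_apply, ih, opH_apply, pow_succ _ b, C_mul, mul_assoc]

theorem repU_ordered_monomial (n : ℕ × ℕ × ℕ) :
    repU (toU h ^ n.1 * (toU f ^ n.2.1 * toU e ^ n.2.2)) =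
      opH ^ n.1 * (opF ^ n.2.1 * opE ^ n.2.2) := by
  simp only [map_mul, map_pow, repU_e, repU_f, repU_h]

/-- The action of `U𝔤` on delta functions is faithful. -/
theorem eq_zero_of_repU_delta {u : U} (hu : ∀ l₀ k₀, repU u (delta l₀ k₀) = 0) : u = 0 := by
  have hspan : u ∈ Submodule.span ℂ (Set.range fun n : ℕ × ℕ × ℕ =>
      toU h ^ n.1 * (toU f ^ n.2.1 * toU e ^ n.2.2)) := by
    rw [span_ordered_monomials_U]; trivial
  obtain ⟨c, rfl⟩ := Finsupp.mem_span_range_iff_exists_finsupp.1 hspan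
  let ν : ℕ × ℕ × ℕ ↪ ReducedExponent :=
    ⟨fun n => ⟨0, n.1, n.2.1, n.2.2, 0, 0, Or.inr zero_le_one⟩, by
      rintro ⟨b, a, c⟩ ⟨b', a', c'⟩ hn
      simpa [ReducedExponent.ext_iff] using hn⟩
  have hc : c.embDomain ν = 0 := by
    apply eq_zero_of_sum_reducedOp_delta 0
    intro l₀ k₀ l k
    have := congrFun (congrFun (hu l₀ k₀) l) k
    rw [Finsupp.sum, map_sum, LinearMap.sum_apply, Finset.sum_apply, Finset.sum_apply] at this
    rw [Pi.zero_apply, Pi.zero_apply] at this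
    rw [Finsupp.support_embDomain, Finset.sum_map, ← this]
    refine Finset.sum_congr rfl fun n _ => ?_
    rw [Finsupp.embDomain_apply_self, map_smul, repU_ordered_monomial, LinearMap.smul_apply,
      Pi.smul_apply, Pi.smul_apply, Module.End.mul_apply, opH_pow_apply, smul_eq_C_mul]
    change C (c n * (2 * (l : ℂ) + k) ^ n.1) * X ^ 0 *
      (opF ^ n.2.1 * opE ^ n.2.2 * (opY 0 ^ 0 * opX 0 ^ 0)) (delta l₀ k₀) l k = _
    simp only [pow_zero, mul_one, C_mul, mul_assoc]
  rw [Finsupp.embDomain_eq_zero.1 hc, Finsupp.sum_zero_index]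

/-- The joint eigenvalues of `h` and `Δ` at distinct lattice points are distinct, so an operator
that commutes with both is diagonal. -/
theorem apply_eq_zero_of_commute {A : Module.End ℂ LatticeFn} (hH : Commute A opH)
    (hC : Commute A (repU casimir)) {ψ : LatticeFn} {l₀ k₀ : ℤ}
    (hψ : ∀ l k, ¬(l = l₀ ∧ k = k₀) → ψ l k = 0) (l k : ℤ) (hlk : ¬(l = l₀ ∧ k = k₀)) :
    A ψ l k = 0 := by
  by_contra hne
  have h1 : opH ψ = (2 * (l₀ : ℂ) + k₀) • ψ := by
    funext l k
    rw [opH_apply, Pi.smul_apply, Pi.smul_apply, smul_eq_C_mul]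
    by_cases hlk : l = l₀ ∧ k = k₀
    · rw [hlk.1, hlk.2]
    · rw [hψ l k hlk, mul_zero, mul_zero]
  have h2 : repU casimir ψ = (spec k₀ ^ 2 - 1) • ψ := by
    funext l k
    rw [repU_casimir, Pi.smul_apply, Pi.smul_apply, smul_eq_C_mul]
    by_cases hlk : l = l₀ ∧ k = k₀
    · rw [hlk.2]
    · rw [hψ l k hlk, mul_zero, mul_zero]
  have h3 := congrFun (congrFun (LinearMap.congr_fun hH.eq ψ) l) k
  have h4 := congrFun (congrFun (LinearMap.congr_fun hC.eq ψ) l) k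
  rw [Module.End.mul_apply, Module.End.mul_apply, h1, map_smul, opH_apply, Pi.smul_apply,
    Pi.smul_apply, smul_eq_C_mul] at h3
  rw [Module.End.mul_apply, Module.End.mul_apply, h2, map_smul, repU_casimir, Pi.smul_apply,
    Pi.smul_apply, smul_eq_C_mul] at h4
  have h5 := C_injective (mul_right_cancel₀ hne h3)
  have h6 := C_injective (mul_right_cancel₀ hne h4)
  have hk : k = k₀ := (spec_sq_injective (sub_left_injective h6)).symm
  subst hk
  apply hlk
  refine ⟨?_, rfl⟩
  have h7 : (l₀ : ℂ) = l := mul_left_cancel₀ two_ne_zero (add_right_cancel h5)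
  exact (Int.cast_injective h7).symm

theorem opE_delta (l k : ℤ) : opE (delta l k) = delta (l + 1) k := by
  funext l' k'
  simp only [opE_apply, delta, sub_eq_iff_eq_add]

/-- `fᵃ eᵃ` is a polynomial in `h` (the inner variable) and `Δ` (the outer variable). -/
theorem exists_opF_pow_mul_opE_pow (a : ℕ) : ∃ P : ℂ[X][X], ∀ φ l k,
    (opF ^ a * opE ^ a) φ l k = C (P.evalEval (2 * (l : ℂ) + k) (spec k ^ 2 - 1)) * φ l k := by
  induction a with
  | zero => exact ⟨1, by simp [evalEval]⟩
  | succ a ih =>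
    obtain ⟨P, hP⟩ := ih
    refine ⟨C (C (1 / 4)) * (X + 1 - C ((X + 1) ^ 2)) *
      (P.map (compRingHom (X - C (-2)))).comp (X - C (C 0)), fun φ l k => ?_⟩
    rw [pow_succ', pow_succ, mul_assoc, ← mul_assoc (opF ^ a), Module.End.mul_apply, opF_apply,
      Module.End.mul_apply, hP, opE_apply, evalEval_mul, evalEval_map_comp, ← mul_assoc, ← C_mul,
      add_sub_cancel_right]
    congr 2
    simp only [evalEval, eval_mul, eval_sub, eval_add, eval_pow, eval_X, eval_C, eval_one]
    congr 1
    · ring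
    · push_cast
      rw [sub_zero]
      congr 1; ring

theorem opF_pow_mul_opE_pow_delta_of_ne {a c : ℕ} (hac : a ≠ c) (l k : ℤ) :
    (opF ^ a * opE ^ c) (delta l k) l k = 0 := by
  have hE : ∀ c : ℕ, (opE ^ c) (delta l k) = delta (l + c) k := by
    intro c
    induction c with
    | zero => simp
    | succ c ih => rw [pow_succ', Module.End.mul_apply, ih, opE_delta]; push_cast; rw [add_assoc]
  have hF : ∀ (a : ℕ) (φ : LatticeFn) (l k : ℤ), φ (l + a) k = 0 → (opF ^ a) φ l k = 0 := by
    intro a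
    induction a with
    | zero => intro φ l k h0; simpa using h0
    | succ a ih =>
      intro φ l k h0
      rw [pow_succ', Module.End.mul_apply, opF_apply, ih, mul_zero]
      rw [← h0]; congr 1; push_cast; ring
  rw [Module.End.mul_apply, hE]
  exact hF _ _ _ _ (delta_of_ne (by omega))

/-- The center of `U𝔤` is `ℂ[Δ]`. -/
theorem exists_eq_aeval_casimir {z : U} (hz : z ∈ Subalgebra.center ℂ U) :
    ∃ q : ℂ[X], z = aeval casimir q := by
  have hspan : z ∈ Submodule.span ℂ (Set.range fun n : ℕ × ℕ × ℕ =>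
      toU h ^ n.1 * (toU f ^ n.2.1 * toU e ^ n.2.2)) := by
    rw [span_ordered_monomials_U]; trivial
  have hdiag : ∃ P : ℂ[X][X], ∀ l k : ℤ,
      repU z (delta l k) l k = C (P.evalEval (2 * (l : ℂ) + k) (spec k ^ 2 - 1)) := by
    clear hz
    induction hspan using Submodule.span_induction with
    | mem u hu =>
      obtain ⟨⟨b, a, c⟩, rfl⟩ := hu
      by_cases hac : a = c
      · subst hac
        obtain ⟨P, hP⟩ := exists_opF_pow_mul_opE_pow a
        refine ⟨C (X ^ b) * P, fun l k => ?_⟩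
        rw [repU_ordered_monomial, Module.End.mul_apply, opH_pow_apply, hP, delta_self, mul_one,
          ← C_mul]
        simp [evalEval]
      · refine ⟨0, fun l k => ?_⟩
        rw [repU_ordered_monomial, Module.End.mul_apply, opH_pow_apply,
          opF_pow_mul_opE_pow_delta_of_ne hac]
        simp [evalEval]
    | zero => exact ⟨0, by simp [evalEval]⟩
    | add u v _ _ hu hv =>
      obtain ⟨P, hP⟩ := hu
      obtain ⟨Q, hQ⟩ := hv
      exact ⟨P + Q, fun l k => by simp [evalEval, hP, hQ]⟩
    | smul r u _ hu =>
      obtain ⟨P, hP⟩ := hu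
      exact ⟨C (C r) * P, fun l k => by simp [evalEval, hP, smul_eq_C_mul]⟩
  obtain ⟨P, hP⟩ := hdiag
  have hcomm : ∀ u, Commute (repU z) (repU u) := fun u => by
    rw [commute_iff_eq, ← map_mul, ← map_mul, Subalgebra.mem_center_iff.1 hz u]
  have hH : Commute (repU z) opH := repU_h ▸ hcomm (toU h)
  have hE : Commute (repU z) opE := repU_e ▸ hcomm (toU e)
  have hstep : ∀ l k : ℤ, repU z (delta l k) l k = repU z (delta 0 k) 0 k := by
    have h1 : ∀ l k : ℤ, repU z (delta (l + 1) k) (l + 1) k = repU z (delta l k) l k := by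
      intro l k
      have := congrFun (congrFun (LinearMap.congr_fun hE.eq (delta l k)) (l + 1)) k
      rwa [Module.End.mul_apply, Module.End.mul_apply, opE_delta, opE_apply,
        add_sub_cancel_right] at this
    intro l k
    induction l with
    | zero => rfl
    | succ n ih => rw [h1, ih]
    | pred n ih => rw [← ih, ← h1, sub_add_cancel]
  refine ⟨P.map (evalRingHom 0), ?_⟩
  rw [← sub_eq_zero]
  apply eq_zero_of_repU_delta
  intro l₀ k₀
  funext l k
  rw [map_sub, LinearMap.sub_apply, Pi.sub_apply, Pi.sub_apply, repU_aeval_casimir, Pi.zero_apply,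
    Pi.zero_apply]
  by_cases hlk : l = l₀ ∧ k = k₀
  · obtain ⟨rfl, rfl⟩ := hlk
    rw [delta_self, mul_one, hP, ← C_sub, C_eq_zero, sub_eq_zero, eval_map]
    -- the diagonal entry does not depend on `l`, hence not on the eigenvalue of `h`
    have hconst : P.eval (C (spec k ^ 2 - 1)) =
        C ((P.eval (C (spec k ^ 2 - 1))).eval (2 * ((0 : ℤ) : ℂ) + k)) := by
      rw [← sub_eq_zero]
      apply eq_zero_of_infinite_isRoot
      refine Set.infinite_of_injective_forall_mem (f := fun l : ℤ => 2 * (l : ℂ) + k) ?_ ?_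
      · intro l l' hl
        simpa using hl
      · intro l
        have := hstep l k
        rw [hP, hP] at this
        simpa [evalEval, sub_eq_zero] using C_injective this
    have hz0 : eval₂ (evalRingHom 0) (spec k ^ 2 - 1) P =
        (P.eval (C (spec k ^ 2 - 1))).eval 0 := by
      rw [← coe_evalRingHom 0, ← eval₂_hom]
      simp
    rw [hz0, evalEval, hconst, eval_C, eval_C]
  · rw [delta_of_ne hlk, mul_zero, sub_zero]
    exact apply_eq_zero_of_commute hH (hcomm casimir) (fun l k => delta_of_ne) l k hlk

/-! ### The center of `H_z` -/

section

variable {z : U} {q p : ℂ[X]}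

theorem rep_aeval_t (hz : z = aeval casimir q) (hqp : OmegaIdentity q p)
    (P : ℂ[X]) (φ : LatticeFn) (l k : ℤ) :
    rep hz hqp (aeval (t z p) P) φ l k = P * φ l k := by
  induction P using Polynomial.induction_on' generalizing φ with
  | add P Q hP hQ => simp only [map_add, LinearMap.add_apply, Pi.add_apply, hP, hQ, add_mul]
  | monomial n r =>
    rw [aeval_monomial, ← C_mul_X_pow_eq_monomial, ← Algebra.smul_def, map_smul,
      LinearMap.smul_apply, Pi.smul_apply, Pi.smul_apply, smul_eq_C_mul, mul_assoc]
    congr 1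
    induction n generalizing φ with
    | zero => simp
    | succ n ih => rw [pow_succ, map_mul, Module.End.mul_apply, ih, rep_t, pow_succ, mul_assoc]

theorem rep_reducedMonomial (hz : z = aeval casimir q) (hqp : OmegaIdentity q p)
    (n : ReducedExponent) (φ : LatticeFn) (l k : ℤ) :
    rep hz hqp (reducedMonomial z p n) φ l k =
      C ((2 * (l : ℂ) + k) ^ n.b) * X ^ n.m * reducedOp (downCoeff q p) n φ l k := by
  have h1 := rep_aeval_t hz hqp (X ^ n.m)
  simp only [map_pow, aeval_X] at h1
  have h2 := repU_ordered_monomial (n.b, n.a, n.c)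
  rw [reducedMonomial, map_mul, map_pow, Module.End.mul_apply, h1, map_mul, rep_inU, h2, map_mul,
    map_pow, map_pow, rep_x, rep_y, mul_assoc, Module.End.mul_apply, opH_pow_apply, reducedOp]
  ring

/-- The representation is faithful, already on delta functions. -/
theorem eq_zero_of_rep_delta (hz : z = aeval casimir q) (hqp : OmegaIdentity q p) {a : H z}
    (ha : ∀ l₀ k₀, rep hz hqp a (delta l₀ k₀) = 0) : a = 0 := by
  have hspan : a ∈ Submodule.span ℂ (Set.range (reducedMonomial z p)) := by
    rw [span_reducedMonomial (hz ▸ aeval_casimir_mem_center q) (isOmega_of_omegaIdentity hz hqp)]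
    trivial
  obtain ⟨c, rfl⟩ := Finsupp.mem_span_range_iff_exists_finsupp.1 hspan
  have hc : c = 0 := by
    apply eq_zero_of_sum_reducedOp_delta (downCoeff q p)
    intro l₀ k₀ l k
    have := congrFun (congrFun (ha l₀ k₀) l) k
    rw [Finsupp.sum, map_sum, LinearMap.sum_apply, Finset.sum_apply, Finset.sum_apply] at this
    rw [Pi.zero_apply, Pi.zero_apply] at this
    rw [← this]
    refine Finset.sum_congr rfl fun n _ => ?_
    rw [map_smul, LinearMap.smul_apply, Pi.smul_apply, Pi.smul_apply, rep_reducedMonomial,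
      smul_eq_C_mul, C_mul]
    ring
  rw [hc, Finsupp.sum_zero_index]

theorem aeval_t_injective (hz : z = aeval casimir q) (hqp : OmegaIdentity q p) :
    Function.Injective (aeval (R := ℂ) (t z p)) := by
  rw [injective_iff_map_eq_zero]
  intro P hP
  have := rep_aeval_t hz hqp P (delta 0 0) 0 0
  rw [hP, delta_self, mul_one] at this
  simpa using this.symm

theorem opX_delta (g : ℤ → ℂ[X]) (l k : ℤ) :
    opX g (delta l k) = delta l (k + 1) + (g k) • delta (l + 1) (k - 1) := by
  funext l' k'
  have h1 : (k' - 1 = k) = (k' = k + 1) := by rw [sub_eq_iff_eq_add]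
  have h2 : (l' - 1 = l) = (l' = l + 1) := by rw [sub_eq_iff_eq_add]
  have h3 : (k' + 1 = k) = (k' = k - 1) := by rw [eq_sub_iff_add_eq]
  rw [opX_apply, Pi.add_apply, Pi.add_apply, Pi.smul_apply, Pi.smul_apply, smul_eq_mul]
  simp only [delta, h1, h2, h3]
  by_cases hk : l' = l + 1 ∧ k' = k - 1
  · rw [hk.2, sub_add_cancel]
  · rw [if_neg hk, mul_zero, mul_zero]

/-- A central element is diagonal, and its diagonal entries are constant along the shifts by `e`
and `x`, which act transitively on the lattice. -/
theorem exists_eq_aeval_t (hz : z = aeval casimir q) (hqp : OmegaIdentity q p) {a : H z}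
    (ha : a ∈ Subalgebra.center ℂ (H z)) :
    ∃ P : ℂ[X], aeval (t z p) P = a := by
  set A := rep hz hqp a
  have hcomm : ∀ b, Commute A (rep hz hqp b) := fun b => by
    rw [commute_iff_eq, ← map_mul, ← map_mul, Subalgebra.mem_center_iff.1 ha b]
  have hH : Commute A opH := by simpa only [rep_inU, repU_h] using hcomm (inU z (toU h))
  have hE : Commute A opE := by simpa only [rep_inU, repU_e] using hcomm (inU z (toU e))
  have hC : Commute A (repU casimir) := by simpa only [rep_inU] using hcomm (inU z casimir)
  have hX : Commute A (opX (downCoeff q p)) := by simpa only [rep_x] using hcomm (x z)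
  have hdiag : ∀ l₀ k₀ l k, ¬(l = l₀ ∧ k = k₀) → A (delta l₀ k₀) l k = 0 := fun l₀ k₀ =>
    apply_eq_zero_of_commute hH hC fun l k => delta_of_ne
  have h1 : ∀ l k : ℤ, A (delta (l + 1) k) (l + 1) k = A (delta l k) l k := by
    intro l k
    have := congrFun (congrFun (LinearMap.congr_fun hE.eq (delta l k)) (l + 1)) k
    rwa [Module.End.mul_apply, Module.End.mul_apply, opE_delta, opE_apply,
      add_sub_cancel_right] at this
  have h2 : ∀ l k : ℤ, A (delta l (k + 1)) l (k + 1) = A (delta l k) l k := by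
    intro l k
    have := congrFun (congrFun (LinearMap.congr_fun hX.eq (delta l k)) l) (k + 1)
    rw [Module.End.mul_apply, Module.End.mul_apply, opX_delta, map_add, Pi.add_apply, Pi.add_apply,
      opX_apply, add_sub_cancel_right, hdiag l k (l - 1) (k + 1 + 1) (by omega), mul_zero,
      add_zero, apply_eq_zero_of_commute hH hC (ψ := downCoeff q p k • delta (l + 1) (k - 1))
        (l₀ := l + 1) (k₀ := k - 1) _ l (k + 1) (by omega),
      add_zero] at this
    · exact this
    · intro l' k' hlk
      rw [Pi.smul_apply, Pi.smul_apply, delta_of_ne hlk, smul_zero]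
  have h3 : ∀ l k : ℤ, A (delta l k) l k = A (delta 0 k) 0 k := by
    intro l k
    induction l with
    | zero => rfl
    | succ n ih => rw [h1, ih]
    | pred n ih => rw [← ih, ← h1, sub_add_cancel]
  have h4 : ∀ k : ℤ, A (delta 0 k) 0 k = A (delta 0 0) 0 0 := by
    intro k
    induction k with
    | zero => rfl
    | succ n ih => rw [h2, ih]
    | pred n ih => rw [← ih, ← h2, sub_add_cancel]
  refine ⟨A (delta 0 0) 0 0, ?_⟩
  rw [← sub_eq_zero]
  apply eq_zero_of_rep_delta hz hqp
  intro l₀ k₀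
  funext l k
  rw [map_sub, LinearMap.sub_apply, Pi.sub_apply, Pi.sub_apply, rep_aeval_t, Pi.zero_apply,
    Pi.zero_apply, sub_eq_zero]
  by_cases hlk : l = l₀ ∧ k = k₀
  · obtain ⟨rfl, rfl⟩ := hlk
    rw [delta_self, mul_one, ← h4 k, ← h3 l k]
  · rw [delta_of_ne hlk, mul_zero]
    exact (hdiag _ _ _ _ hlk).symm

/-- The equation for `ω_z` in `H_z` determines `ω_z` up to a constant, and therefore implies the
identity between polynomials. -/
theorem IsOmega.omegaIdentity (hz : z = aeval casimir q) {p' : ℂ[X]} (hp' : IsOmega z p') :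
    OmegaIdentity q p' := by
  obtain ⟨p, hqp⟩ := exists_omegaIdentity q
  have hp := isOmega_of_omegaIdentity hz hqp
  set d := p' - p with hd
  have hcomm : x z * inU z (aeval casimir d) = inU z (aeval casimir d) * x z := by
    have h1 := hp'.trans hp.symm
    simp only [bracket] at h1
    rw [hd, map_sub, map_sub]
    linear_combination (norm := noncomm_ring) h1
  have hstep : ∀ k : ℤ, d.eval (spec (k + 1) ^ 2 - 1) = d.eval (spec k ^ 2 - 1) := by
    intro k
    have h1 := congrArg (rep hz hqp) hcomm
    rw [map_mul, map_mul, rep_inU, rep_x] at h1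
    have h2 := congrFun (congrFun (LinearMap.congr_fun h1 (delta 0 k)) 0) (k + 1)
    simp only [Module.End.mul_apply, opX_apply, repU_aeval_casimir, add_sub_cancel_right,
      delta_self, delta_of_ne (show ¬((0 : ℤ) - 1 = 0 ∧ k + 1 + 1 = k) by omega), mul_zero,
      add_zero, mul_one] at h2
    exact C_injective h2.symm
  have hall : ∀ k : ℤ, d.eval (spec k ^ 2 - 1) = d.eval (spec 0 ^ 2 - 1) := by
    intro k
    induction k with
    | zero => rfl
    | succ n ih => rw [hstep, ih]
    | pred n ih => rw [← ih, ← hstep, sub_add_cancel]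
  have hconst : d - C (d.eval (spec 0 ^ 2 - 1)) = 0 := by
    apply eq_zero_of_infinite_isRoot
    refine Set.infinite_of_injective_forall_mem (f := fun k : ℤ => spec k ^ 2 - 1) ?_ ?_
    · exact fun k k' hk => spec_sq_injective (sub_left_injective hk)
    · intro k
      simp [hall k]
  have hp'' : p' = p + C (d.eval (spec 0 ^ 2 - 1)) := by
    linear_combination hconst + hd.symm
  rw [OmegaIdentity, ← hqp, hp'', add_comp, add_comp, C_comp, C_comp]
  ring

/-! ### The filtration degree of `t_z` -/

theorem t_mem_filtration (z : U) (p : ℂ[X]) : t z p ∈ filtration z 2 := by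
  have hmem : ∀ k ≤ 2, (inU z).toLinearMap.range *
      ((inV z).range * (inU z).toLinearMap.range) ^ k ≤ filtration z 2 := fun k hk =>
    le_iSup₂_of_le k (Finset.mem_range.2 (by omega)) le_rfl
  have h1 : ∀ v, inV z v ∈ (inV z).range * (inU z).toLinearMap.range := fun v => by
    rw [← mul_one (inV z v)]
    exact Submodule.mul_mem_mul ⟨v, rfl⟩ ⟨1, map_one (inU z)⟩
  have h2 : ∀ u v w, inU z u * (inV z v * inV z w) ∈ filtration z 2 := fun u v w => by
    refine hmem 2 le_rfl (Submodule.mul_mem_mul ⟨u, rfl⟩ ?_)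
    rw [pow_two]
    exact Submodule.mul_mem_mul (h1 v) (h1 w)
  have h0 : ∀ u, inU z u ∈ filtration z 2 := fun u => by
    refine hmem 0 (by omega) ?_
    rw [pow_zero, mul_one]
    exact ⟨u, rfl⟩
  rw [t, sq, sq, mul_assoc (inU z (toU h))]
  exact Submodule.sub_mem _ (Submodule.sub_mem _ (Submodule.sub_mem _ (Submodule.add_mem _
    (h2 _ _ _) (h2 _ _ _)) (h2 _ _ _)) (Submodule.smul_mem _ _ (h0 _))) (h0 _)

theorem repU_apply_mem_range_C (u : U) (φ : LatticeFn)
    (hφ : ∀ l k, φ l k ∈ (C : ℂ →+* ℂ[X]).range) (l k : ℤ) :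
    repU u φ l k ∈ (C : ℂ →+* ℂ[X]).range := by
  let S : Subalgebra ℂ U :=
    { carrier := {u | ∀ φ : LatticeFn, (∀ l k, φ l k ∈ (C : ℂ →+* ℂ[X]).range) →
        ∀ l k, repU u φ l k ∈ (C : ℂ →+* ℂ[X]).range}
      mul_mem' := fun {a b} ha hb φ hφ => by
        rw [map_mul]; exact ha _ (hb φ hφ)
      add_mem' := fun {a b} ha hb φ hφ l k => by
        rw [map_add]; exact add_mem (ha φ hφ l k) (hb φ hφ l k)
      algebraMap_mem' := fun r φ hφ l k => by
        rw [AlgHom.commutes, Module.algebraMap_end_apply, Pi.smul_apply, Pi.smul_apply,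
          smul_eq_C_mul]
        exact mul_mem ⟨r, rfl⟩ (hφ l k) }
  refine mem_of_generators S ?_ ?_ ?_ u φ hφ l k <;> intro φ hφ l k
  · rw [repU_e]; exact hφ _ _
  · rw [repU_f]; exact mul_mem ⟨_, rfl⟩ (hφ _ _)
  · rw [repU_h]; exact mul_mem ⟨_, rfl⟩ (hφ _ _)

/-- `U𝔤` does not change `k`. -/
theorem repU_apply_eq_zero (u : U) (φ : LatticeFn) (k : ℤ) (hφ : ∀ l, φ l k = 0) (l : ℤ) :
    repU u φ l k = 0 := by
  let S : Subalgebra ℂ U :=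
    { carrier := {u | ∀ φ : LatticeFn, (∀ l, φ l k = 0) → ∀ l, repU u φ l k = 0}
      mul_mem' := fun {a b} ha hb φ hφ => by
        rw [map_mul]; exact ha _ (hb φ hφ)
      add_mem' := fun {a b} ha hb φ hφ l => by
        rw [map_add, LinearMap.add_apply, Pi.add_apply, Pi.add_apply, ha φ hφ, hb φ hφ, add_zero]
      algebraMap_mem' := fun r φ hφ l => by
        rw [AlgHom.commutes, Module.algebraMap_end_apply, Pi.smul_apply, Pi.smul_apply, hφ,
          smul_zero] }
  refine mem_of_generators S ?_ ?_ ?_ u φ hφ l <;> intro φ hφ l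
  · rw [repU_e]; exact hφ _
  · rw [repU_f, opF_apply, hφ, mul_zero]
  · rw [repU_h, opH_apply, hφ, mul_zero]

/-- On filtration degree at most `1` the diagonal entries are constants, but those of `t_z` are
`X`. -/
theorem two_le_of_t_mem_filtration (hz : z = aeval casimir q) (hqp : OmegaIdentity q p)
    {m : ℕ} (hm : t z p ∈ filtration z m) : 2 ≤ m := by
  by_contra hlt
  let S : Submodule ℂ (H z) :=
    { carrier := {a | rep hz hqp a (delta 0 0) 0 0 ∈ (C : ℂ →+* ℂ[X]).range}
      zero_mem' := by
        rw [Set.mem_ofPred_eq, map_zero]; exact zero_mem _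
      add_mem' := fun {a b} ha hb => by
        rw [Set.mem_ofPred_eq, map_add]; exact add_mem ha hb
      smul_mem' := fun r a ha => by
        rw [Set.mem_ofPred_eq, map_smul, LinearMap.smul_apply, Pi.smul_apply, Pi.smul_apply,
          smul_eq_C_mul]
        exact mul_mem ⟨r, rfl⟩ ha }
  have hle : filtration z m ≤ S := by
    refine iSup₂_le fun k hk => ?_
    have hk' := Finset.mem_range.1 hk
    obtain rfl | rfl : k = 0 ∨ k = 1 := by omega
    · rw [pow_zero, mul_one]
      rintro _ ⟨u, rfl⟩
      change rep hz hqp (inU z u) (delta 0 0) 0 0 ∈ (C : ℂ →+* ℂ[X]).range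
      rw [rep_inU]
      refine repU_apply_mem_range_C u _ (fun l k => ?_) 0 0
      rw [delta]
      split_ifs
      · exact one_mem _
      · exact zero_mem _
    · rw [pow_one, Submodule.mul_le]
      rintro _ ⟨u, rfl⟩ b hb
      -- `V` changes `k` by `±1`, so these products have zero diagonal
      have hb0 : ∀ l, rep hz hqp b (delta 0 0) l 0 = 0 := by
        induction hb using Submodule.mul_induction_on' with
        | mem_mul_mem v hv w hw =>
          obtain ⟨v, rfl⟩ := hv
          obtain ⟨w, rfl⟩ := hw
          intro l
          have h1 : ∀ k, k ≠ 0 → ∀ l, rep hz hqp (inU z w) (delta 0 0) l k = 0 := fun k hk l => by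
            rw [rep_inU]
            exact repU_apply_eq_zero w _ k (fun l => delta_of_ne (by omega)) l
          change rep hz hqp (inV z v * inU z w) (delta 0 0) l 0 = 0
          rw [map_mul, Module.End.mul_apply, inV_eq, map_add, map_smul, map_smul, rep_x, rep_y,
            LinearMap.add_apply, LinearMap.smul_apply, LinearMap.smul_apply, Pi.add_apply,
            Pi.add_apply, Pi.smul_apply, Pi.smul_apply, Pi.smul_apply, Pi.smul_apply, opX_apply,
            opY_apply, h1 (0 - 1) (by omega), h1 (0 - 1) (by omega), h1 (0 + 1) (by omega),
            h1 (0 + 1) (by omega)]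
          simp
        | add a _ b _ ha hb =>
          intro l
          rw [map_add, LinearMap.add_apply, Pi.add_apply, Pi.add_apply, ha, hb, add_zero]
      change rep hz hqp (inU z u * b) (delta 0 0) 0 0 ∈ (C : ℂ →+* ℂ[X]).range
      rw [map_mul, Module.End.mul_apply, rep_inU, repU_apply_eq_zero u _ 0 hb0]
      exact zero_mem _
  obtain ⟨r, hr⟩ : rep hz hqp (t z p) (delta 0 0) 0 0 ∈ (C : ℂ →+* ℂ[X]).range := hle hm
  rw [rep_t, delta_self, mul_one] at hr
  exact X_ne_C r hr.symm

end

end InfHecke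

end

theorem theorem1 (z : InfHecke.U) (hz : z ∈ Subalgebra.center ℂ InfHecke.U) :
    (∃ p : ℂ[X], InfHecke.IsOmega z p) ∧
    ∀ p : ℂ[X], InfHecke.IsOmega z p →
      Function.Injective (aeval (R := ℂ) (InfHecke.t z p)) ∧
      (aeval (R := ℂ) (InfHecke.t z p)).range = Subalgebra.center ℂ (InfHecke.H z) ∧
      InfHecke.HasFiltrationDegree z (InfHecke.t z p) 2 := by
  obtain ⟨q, hq⟩ := InfHecke.exists_eq_aeval_casimir hz
  refine ⟨?_, fun p hp => ?_⟩
  · obtain ⟨p, hqp⟩ := InfHecke.exists_omegaIdentity q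
    exact ⟨p, InfHecke.isOmega_of_omegaIdentity hq hqp⟩
  · have hqp := InfHecke.IsOmega.omegaIdentity hq hp
    refine ⟨InfHecke.aeval_t_injective hq hqp, le_antisymm ?_ ?_,
      InfHecke.t_mem_filtration z p, fun m hm => InfHecke.two_le_of_t_mem_filtration hq hqp hm⟩
    · rw [← Algebra.adjoin_singleton_eq_range_aeval]
      exact Algebra.adjoin_le (Set.singleton_subset_iff.2 (InfHecke.t_mem_center hz hp))
    · exact fun a ha => InfHecke.exists_eq_aeval_t hq hqp ha
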